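/- Let $d\ge 0$, $0<\sigma<\tfrac12$, $\theta>1$, $\varepsilon>0$, and let $$M(s)=\begin{cases}\frac14\bigl(1-(1-\sigma)(2s-1)^2\bigr),&0\le s\le 1,\\ \frac{\sigma}{8}\bigl(1+e^{-2(1-\sigma)((2s-1)^2-1)/\sigma}\bigr),&\text{otherwise,}\end{cases}$$ $$F(s)=\begin{cases}s\ln s+\frac{(1-s)^2}{2\sigma}+(1-s)\ln\sigma-\frac\sigma2+\theta(s-s^2),&s\ge1-\sigma,\\ s\ln s+(1-s)\ln(1-s)+\theta(s-s^2),&\sigma\le s\le1-\sigma,\\ (1-s)\ln(1-s)+\frac{s^2}{2\sigma}+s\ln\sigma-\frac\sigma2+\theta(s-s^2),&s\le\sigma,\end{cases}$$ let $B\in\mathbb R$ satisfy $F(s)+B>0$ for all $s\in\mathbb R$, and put $H=F'/\sqrt{F+B}$. Boundary conditions: either (i) $\Omega=\prod_{i=1}^d(a_i,b_i)$ is a box and all functions are periodic, $H^1$ denoting the space of periodic $H^1$ functions on $\Omega$; or (ii) $\Omega\subset\mathbb R^d$ is a bounded domain (nonempty, open, connected) with the segment property (each $x\in\partial\Omega$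 has a neighbourhood $N$ and a vector $y\neq0$ such that $z+ty\in\Omega$ for all $z\in\overline\Omega\cap N$, $0<t<1$; e.g. any bounded Lipschitz domain), with homogeneous Neumann conditions $\partial_{\mathbf n}\phi=\partial_{\mathbf n}\mu=0$, and $H^1=H^1(\Omega)$. Write $(\cdot,\cdot)$, $\|\cdot\|$ for the $L^2(\Omega)$ inner product and norm. Let $\delta t>0$, $\phi^{n-1},\phi^n\in H^1$, $U^n\in L^2(\Omega)$ be arbitrary, and set $\phi^\dagger=\frac32\phi^n-\frac12\phi^{n-1}$, $H^\dagger=H(\phi^\dagger)$. Consider the Crank–Nicolson scheme $$\frac{\phi^{n+1}-\phi^n}{\delta t}=\nabla\cdot\bigl(M(\phi^\dagger)\nabla\mu^{n+\frac12}\bigr),\qquad \mu^{n+\frac12}=-\varepsilon^2\Delta\frac{\phi^{n+1}+\phi^n}2+\frac{U^{n+1}+U^n}2H^\dagger,\qquad 2(U^{n+1}-U^n)=H^\dagger(\phi^{n+1}-\phi^n),$$ the first two equations with the above boundary conditions being understood weakly, i.e. for all $w\in H^1$ $$\Bigl(\frac{\phi^{n+1}-\phi^n}{\delta t},w\Bigr)=-\bigl(M(\phi^\dagger)\nabla\mu^{n+\frac12},\nabla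 w\bigr),\qquad (\mu^{n+\frac12},w)=\varepsilon^2\Bigl(\nabla\frac{\phi^{n+1}+\phi^n}2,\nabla w\Bigr)+\Bigl(\frac{U^{n+1}+U^n}2H^\dagger,w\Bigr).$$ Put $P\phi=-\frac{\varepsilon^2}2\Delta\phi+\frac14(H^\dagger)^2\phi$, i.e. $(P\phi,\psi)=\frac{\varepsilon^2}2(\nabla\phi,\nabla\psi)+\frac14(H^\dagger\phi,H^\dagger\psi)$, and $g=-\frac{\varepsilon^2}2\Delta\phi^n+H^\dagger U^n-\frac14(H^\dagger)^2\phi^n$, also understood weakly. Let $V=\{\psi\in H^1:\int_\Omega\psi=0\}$. For $u\in L^2(\Omega)$ with $\int_\Omega u=0$ let $v=\Delta^{-1}u\in V$ denote the weak solution of $\nabla\cdot(M(\phi^\dagger)\nabla v)=u$, i.e. $-(M(\phi^\dagger)\nabla v,\nabla w)=(u,w)$ for all $w\in H^1$. Then: 1. The scheme has a unique solution $(\phi^{n+1},U^{n+1},\mu^{n+\frac12})\in H^1\times L^2(\Omega)\times H^1$. The linear system $\frac{\phi^{n+1}-\phi^n}{\delta t}=\nabla\cdot(M(\phi^\dagger)\nabla\mu^{n+\frac12})$,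 $\mu^{n+\frac12}=P\phi^{n+1}+g$ (weakly) has a unique solution $(\phi^{n+1},\mu^{n+\frac12})\in H^1\times H^1$, and together with $U^{n+1}=\frac{H^\dagger}2\phi^{n+1}+(U^n-\frac{H^\dagger}2\phi^n)$ it is equivalent to the scheme. 2. With $E(\phi,U)=\frac{\varepsilon^2}2\|\nabla\phi\|^2+\|U\|^2-B|\Omega|$, the solution satisfies $$\frac1{\delta t}\bigl(E(\phi^{n+1},U^{n+1})-E(\phi^n,U^n)\bigr)=-\bigl\|\sqrt{M(\phi^\dagger)}\,\nabla\mu^{n+\frac12}\bigr\|^2\le0 .$$ 3. $\Delta^{-1}u$ exists and is unique for every $u\in L^2(\Omega)$ with $\int_\Omega u=0$. The form $(P\phi,\psi)$ is symmetric on $H^1$ and $(P\psi,\psi)>0$ for $0\ne\psi\in V$. The operator of the linear system, $\mathbb A\psi=-\frac1{\delta t}\Delta^{-1}\psi+P\psi$ (modulo constants), i.e. $$(\mathbb A\psi,\chi)=-\frac1{\delta t}(\Delta^{-1}\psi,\chi)+(P\psi,\chi),\qquad \psi,\chi\in V,$$ is a bounded linear operator from $V$ to its dual $V'$. With $\alpha=\frac1{|\Omega|}\int_\Omega\phi^n$,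 a function $\phi\in H^1$ is the component $\phi^{n+1}$ of a solution of the scheme if and only if $\phi=\psi+\alpha$ with some $\psi\in V$ and $$(\mathbb A\psi,\chi)=-\Bigl(\Delta^{-1}\frac{\phi^n-\alpha}{\delta t},\chi\Bigr)-\Bigl(g+\tfrac14(H^\dagger)^2\alpha,\chi\Bigr)\qquad\text{for all }\chi\in V.$$ Moreover $\mathbb A$ is symmetric, $(\mathbb A\psi,\chi)=(\mathbb A\chi,\psi)$ for all $\psi,\chi\in V$, and positive definite, $(\mathbb A\psi,\psi)>0$ for all $0\neq\psi\in V$. -/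

import Mathlib

open MeasureTheory Filter Topology
open scoped ContDiff

noncomputable section

namespace CahnHilliard

/-! ### Mobility, regularized Flory–Huggins potential and the function `H` -/

/-- The nondegenerate mobility `M`. -/
def mobility (σ s : ℝ) : ℝ :=
  if 0 ≤ s ∧ s ≤ 1 then (1 / 4) * (1 - (1 - σ) * (2 * s - 1) ^ 2)
  else (1 / 8) * σ * (1 + Real.exp (-2 * (1 - σ) * ((2 * s - 1) ^ 2 - 1) / σ))

/-- The regularized logarithmic Flory–Huggins potential `F : ℝ → ℝ`; it is of class `C²` for
`0 < σ < 1 / 2`, and the logarithms below are only taken of positive numbers. -/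
def potential (σ θ s : ℝ) : ℝ :=
  if 1 - σ ≤ s then
    s * Real.log s + (1 - s) ^ 2 / (2 * σ) + (1 - s) * Real.log σ - σ / 2 + θ * (s - s ^ 2)
  else if σ ≤ s then
    s * Real.log s + (1 - s) * Real.log (1 - s) + θ * (s - s ^ 2)
  else
    (1 - s) * Real.log (1 - s) + s ^ 2 / (2 * σ) + s * Real.log σ - σ / 2 + θ * (s - s ^ 2)

/-- `H = f / √(F + B)` with `f = F'`. -/
def hFun (σ θ B s : ℝ) : ℝ :=
  deriv (potential σ θ) s / Real.sqrt (potential σ θ s + B)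

/-! ### Domains, boundary conditions, Sobolev spaces -/

/-- Bounded domains with the segment property: near each boundary point the closure of `Ω` can be
pushed into `Ω` along a fixed nonzero vector. Every bounded Lipschitz domain is of this kind. -/
structure IsRegularDomain {d : ℕ} (Ω : Set (EuclideanSpace ℝ (Fin d))) : Prop where
  isOpen : IsOpen Ω
  isBounded : Bornology.IsBounded Ω
  isConnected : IsConnected Ω
  segment : ∀ x ∈ frontier Ω, ∃ N ∈ 𝓝 x, ∃ y : EuclideanSpace ℝ (Fin d), y ≠ 0 ∧
    ∀ z ∈ closure Ω ∩ N, ∀ t : ℝ, 0 < t → t < 1 → z + t • y ∈ Ω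

/-- The two kinds of boundary conditions, together with the domain: everything periodic on a box
`∏ (aᵢ, bᵢ)`, or homogeneous Neumann (no-flux) conditions on a bounded domain. -/
inductive Setting (d : ℕ) where
  | periodic (a b : Fin d → ℝ) (hab : ∀ i, a i < b i)
  | noFlux (Ω : Set (EuclideanSpace ℝ (Fin d))) (hΩ : IsRegularDomain Ω)

variable {d : ℕ}

/-- The domain `Ω`. -/
def Setting.carrier : Setting d → Set (EuclideanSpace ℝ (Fin d))
  | .periodic a b _ => {x | ∀ i, a i < x i ∧ x i < b i}
  | .noFlux Ω _ => Ω

/-- Smooth functions against which weak derivatives are tested: periodic ones in the periodic case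
(so that the weak derivative is that of the periodic extension), compactly supported ones in `Ω`
in the no-flux case. -/
def Setting.IsTest (S : Setting d) (η : EuclideanSpace ℝ (Fin d) → ℝ) : Prop :=
  ContDiff ℝ ∞ η ∧
    match S with
    | .periodic a b _ => ∀ i x, η (x + EuclideanSpace.single i (b i - a i)) = η x
    | .noFlux Ω _ => HasCompactSupport η ∧ tsupport η ⊆ Ω

/-- Lebesgue measure on `Ω`. -/
abbrev Setting.vol (S : Setting d) : Measure (EuclideanSpace ℝ (Fin d)) :=
  volume.restrict S.carrier

/-- `L²(Ω)`. -/
abbrev L2 (S : Setting d) : Type := Lp ℝ 2 S.vol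

/-- `L²(Ω; ℝᵈ)`. -/
abbrev L2Vec (S : Setting d) : Type := Lp (EuclideanSpace ℝ (Fin d)) 2 S.vol

/-- `G` is the weak gradient of `u`. -/
def IsWeakGradient (S : Setting d) (u : EuclideanSpace ℝ (Fin d) → ℝ)
    (G : EuclideanSpace ℝ (Fin d) → EuclideanSpace ℝ (Fin d)) : Prop :=
  ∀ η, S.IsTest η → ∀ i : Fin d,
    ∫ x, u x * fderiv ℝ η x (EuclideanSpace.single i 1) ∂S.vol = -∫ x, G x i * η x ∂S.vol

theorem Setting.isBounded_carrier (S : Setting d) : Bornology.IsBounded S.carrier := by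
  cases S with
  | periodic a b hab =>
    have h : (WithLp.ofLp : EuclideanSpace ℝ (Fin d) → Fin d → ℝ) ⁻¹' Set.Icc a b ⊇
        (Setting.periodic a b hab).carrier := by
      intro x hx
      exact ⟨fun i => (hx i).1.le, fun i => (hx i).2.le⟩
    refine Bornology.IsBounded.subset ?_ h
    exact (PiLp.antilipschitzWith_ofLp 2 (fun _ : Fin d => ℝ)).isBounded_preimage
      (Metric.isBounded_Icc a b)
  | noFlux Ω hΩ => exact hΩ.isBounded

instance (S : Setting d) : IsFiniteMeasure S.vol :=
  ⟨by simpa using S.isBounded_carrier.measure_lt_top⟩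

theorem Setting.integrable_mul (S : Setting d) {u g : EuclideanSpace ℝ (Fin d) → ℝ}
    (hu : MemLp u 2 S.vol) (hg : Continuous g) : Integrable (fun x => u x * g x) S.vol := by
  have hu1 : Integrable u S.vol := hu.integrable (by norm_num)
  obtain ⟨C, hC⟩ := (S.isBounded_carrier.isCompact_closure).exists_bound_of_continuousOn
    hg.continuousOn
  refine hu1.mul_bdd (c := C) hg.aestronglyMeasurable ?_
  have hcl : ∀ᵐ x ∂S.vol, x ∈ closure S.carrier := by
    have := ae_restrict_mem (μ := (volume : Measure (EuclideanSpace ℝ (Fin d))))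
      (isClosed_closure (s := S.carrier)).measurableSet
    exact ae_mono (Measure.restrict_mono subset_closure le_rfl) this
  filter_upwards [hcl] with x hx using hC x hx

theorem Setting.IsTest.continuous {S : Setting d} {η : EuclideanSpace ℝ (Fin d) → ℝ}
    (h : S.IsTest η) : Continuous η := h.1.continuous

theorem Setting.IsTest.continuous_fderiv {S : Setting d} {η : EuclideanSpace ℝ (Fin d) → ℝ}
    (h : S.IsTest η) (v : EuclideanSpace ℝ (Fin d)) : Continuous fun x => fderiv ℝ η x v :=
  (h.1.continuous_fderiv (by simp)).clm_apply continuous_const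

theorem memLp_coord {S : Setting d} {G : EuclideanSpace ℝ (Fin d) → EuclideanSpace ℝ (Fin d)}
    (hG : MemLp G 2 S.vol) (i : Fin d) : MemLp (fun x => G x i) 2 S.vol :=
  (EuclideanSpace.proj (𝕜 := ℝ) i).comp_memLp' hG

/-- The Sobolev space `H¹(Ω)` (its periodic version in the periodic case), as the space of pairs
`(u, ∇u)` of an `L²` function and its `L²` weak gradient (which `u` determines), with the inner
product `(u, v) + (∇u, ∇v)`. -/
def H1 (S : Setting d) : Submodule ℝ (WithLp 2 (L2 S × L2Vec S)) where
  carrier := {p | IsWeakGradient S p.fst p.snd}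
  zero_mem' := by
    intro η _ i
    have h1 := Lp.coeFn_zero ℝ 2 S.vol
    have h2 := Lp.coeFn_zero (EuclideanSpace ℝ (Fin d)) 2 S.vol
    rw [integral_eq_zero_of_ae, integral_eq_zero_of_ae, neg_zero]
    · filter_upwards [h2] with x hx
      rw [WithLp.zero_snd, hx, Pi.zero_apply, PiLp.zero_apply, zero_mul, Pi.zero_apply]
    · filter_upwards [h1] with x hx
      rw [WithLp.zero_fst, hx, Pi.zero_apply, zero_mul]
  add_mem' := by
    intro p q hp hq η hη i
    have e1 : ∫ x, (p + q).fst x * fderiv ℝ η x (EuclideanSpace.single i 1) ∂S.vol =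
        ∫ x, (p.fst x * fderiv ℝ η x (EuclideanSpace.single i 1) +
          q.fst x * fderiv ℝ η x (EuclideanSpace.single i 1)) ∂S.vol := by
      refine integral_congr_ae ?_
      filter_upwards [Lp.coeFn_add p.fst q.fst] with x hx
      rw [WithLp.add_fst, hx, Pi.add_apply, add_mul]
    have e2 : ∫ x, (p + q).snd x i * η x ∂S.vol =
        ∫ x, (p.snd x i * η x + q.snd x i * η x) ∂S.vol := by
      refine integral_congr_ae ?_
      filter_upwards [Lp.coeFn_add p.snd q.snd] with x hx
      rw [WithLp.add_snd, hx, Pi.add_apply, PiLp.add_apply, add_mul]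
    rw [e1, e2, integral_add (S.integrable_mul (Lp.memLp _) (hη.continuous_fderiv _))
      (S.integrable_mul (Lp.memLp _) (hη.continuous_fderiv _)),
      integral_add (S.integrable_mul (memLp_coord (Lp.memLp _) i) hη.continuous)
      (S.integrable_mul (memLp_coord (Lp.memLp _) i) hη.continuous), hp η hη i, hq η hη i]
    ring
  smul_mem' := by
    intro c p hp η hη i
    have e1 : ∫ x, (c • p).fst x * fderiv ℝ η x (EuclideanSpace.single i 1) ∂S.vol =
        ∫ x, c * (p.fst x * fderiv ℝ η x (EuclideanSpace.single i 1)) ∂S.vol := by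
      refine integral_congr_ae ?_
      filter_upwards [Lp.coeFn_smul c p.fst] with x hx
      rw [WithLp.smul_fst, hx, Pi.smul_apply, smul_eq_mul, mul_assoc]
    have e2 : ∫ x, (c • p).snd x i * η x ∂S.vol = ∫ x, c * (p.snd x i * η x) ∂S.vol := by
      refine integral_congr_ae ?_
      filter_upwards [Lp.coeFn_smul c p.snd] with x hx
      rw [WithLp.smul_snd, hx, Pi.smul_apply, PiLp.smul_apply, smul_eq_mul, mul_assoc]
    rw [e1, e2, integral_const_mul, integral_const_mul, hp η hη i]
    ring

/-- The underlying `L²` function of an element of `H¹`. -/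
def fn {S : Setting d} (u : H1 S) : L2 S := u.1.fst

/-- The gradient of an element of `H¹`. -/
def grad {S : Setting d} (u : H1 S) : L2Vec S := u.1.snd

/-- The elements of `H¹` with zero integral. -/
def meanZero (S : Setting d) : Submodule ℝ (H1 S) where
  carrier := {u | ∫ x, fn u x ∂S.vol = 0}
  zero_mem' := by
    refine integral_eq_zero_of_ae ?_
    filter_upwards [Lp.coeFn_zero ℝ 2 S.vol] with x hx using hx
  add_mem' := by
    intro u v hu hv
    have e : ∫ x, fn (u + v) x ∂S.vol = ∫ x, (fn u x + fn v x) ∂S.vol := by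
      refine integral_congr_ae ?_
      filter_upwards [Lp.coeFn_add (fn u) (fn v)] with x hx using hx
    change ∫ x, fn (u + v) x ∂S.vol = 0
    rw [e, integral_add ((Lp.memLp (fn u)).integrable (by norm_num))
      ((Lp.memLp (fn v)).integrable (by norm_num)), hu, hv, add_zero]
  smul_mem' := by
    intro c u hu
    have e : ∫ x, fn (c • u) x ∂S.vol = ∫ x, c * fn u x ∂S.vol := by
      refine integral_congr_ae ?_
      filter_upwards [Lp.coeFn_smul c (fn u)] with x hx using hx
    change ∫ x, fn (c • u) x ∂S.vol = 0
    rw [e, integral_const_mul, hu, mul_zero]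

/-- The mean value over `Ω`. -/
def mean {S : Setting d} (u : H1 S) : ℝ := (∫ x, fn u x ∂S.vol) / volume.real S.carrier

/-! ### The Crank–Nicolson scheme -/

/-- `φ† = (3/2) φⁿ - (1/2) φⁿ⁻¹`. -/
def extrapolate {S : Setting d} (φprev φn : H1 S) (x : EuclideanSpace ℝ (Fin d)) : ℝ :=
  (3 / 2) * fn φn x - (1 / 2) * fn φprev x

/-- `(M(φ†) ∇u, ∇w)`. -/
def mobilityForm {S : Setting d} (σ : ℝ) (φdag : EuclideanSpace ℝ (Fin d) → ℝ) (u w : H1 S) : ℝ :=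
  ∫ x, mobility σ (φdag x) * inner ℝ (grad u x) (grad w x) ∂S.vol

/-- `(φⁿ⁺¹, Uⁿ⁺¹, μⁿ⁺¹ᐟ²) = (φ, U, μ)` is a solution in `H¹ × L² × H¹` of the Crank–Nicolson scheme
with data `φⁿ⁻¹, φⁿ, Uⁿ`, in the weak form: the periodic or no-flux boundary conditions are encoded
by the choice of the test functions `w`. -/
structure IsStep {S : Setting d} (ε σ θ B δt : ℝ) (φprev φn : H1 S) (Un : L2 S)
    (φ : H1 S) (U : L2 S) (μ : H1 S) : Prop where
  evolution : ∀ w : H1 S,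
    ∫ x, (fn φ x - fn φn x) / δt * fn w x ∂S.vol =
      -mobilityForm σ (extrapolate φprev φn) μ w
  chemical : ∀ w : H1 S,
    ∫ x, fn μ x * fn w x ∂S.vol =
      ε ^ 2 * (∫ x, inner ℝ ((1 / 2 : ℝ) • (grad φ x + grad φn x)) (grad w x) ∂S.vol) +
      (∫ x, (U x + Un x) / 2 * hFun σ θ B (extrapolate φprev φn x) * fn w x ∂S.vol)
  auxiliary : ∀ᵐ x ∂S.vol,
    2 * (U x - Un x) = hFun σ θ B (extrapolate φprev φn x) * (fn φ x - fn φn x)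

/-- `(P φ, ψ)` for the operator `P φ = -(ε² / 2) Δ φ + (1 / 4) (H†)² φ` obtained by eliminating
`Uⁿ⁺¹` from the scheme. -/
def pForm {S : Setting d} (ε σ θ B : ℝ) (φdag : EuclideanSpace ℝ (Fin d) → ℝ) (φ ψ : H1 S) : ℝ :=
  ε ^ 2 / 2 * (∫ x, inner ℝ (grad φ x) (grad ψ x) ∂S.vol) +
    (1 / 4) * (∫ x, (hFun σ θ B (φdag x) * fn φ x) * (hFun σ θ B (φdag x) * fn ψ x) ∂S.vol)

/-- `(g, ψ)` for `g = -(ε² / 2) Δ φⁿ + H† Uⁿ - (1 / 4) (H†)² φⁿ + (1 / 4) (H†)² α`. -/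
def gForm {S : Setting d} (ε σ θ B : ℝ) (φprev φn : H1 S) (Un : L2 S) (α : ℝ) (ψ : H1 S) : ℝ :=
  ε ^ 2 / 2 * (∫ x, inner ℝ (grad φn x) (grad ψ x) ∂S.vol) +
    (∫ x, (hFun σ θ B (extrapolate φprev φn x) * Un x
      - (1 / 4) * hFun σ θ B (extrapolate φprev φn x) ^ 2 * fn φn x
      + (1 / 4) * hFun σ θ B (extrapolate φprev φn x) ^ 2 * α) * fn ψ x ∂S.vol)

/-- The linear system `(φ - φⁿ) / δt = ∇ · (M(φ†) ∇μ)`, `μ = P φ + g` for `(φ, μ)`, weakly. -/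
structure IsReducedStep {S : Setting d} (ε σ θ B δt : ℝ) (φprev φn : H1 S) (Un : L2 S)
    (φ μ : H1 S) : Prop where
  evolution : ∀ w : H1 S,
    ∫ x, (fn φ x - fn φn x) / δt * fn w x ∂S.vol =
      -mobilityForm σ (extrapolate φprev φn) μ w
  chemical : ∀ w : H1 S,
    ∫ x, fn μ x * fn w x ∂S.vol =
      pForm ε σ θ B (extrapolate φprev φn) φ w + gForm ε σ θ B φprev φn Un 0 w

/-- `v = Δ⁻¹ u`: the solution with zero mean of `∇ · (M(φ†) ∇v) = u` under the periodic or no-flux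
boundary condition, weakly. -/
structure IsInvLaplace {S : Setting d} (σ : ℝ) (φdag : EuclideanSpace ℝ (Fin d) → ℝ)
    (u : EuclideanSpace ℝ (Fin d) → ℝ) (v : H1 S) : Prop where
  mean_zero : v ∈ meanZero S
  weak : ∀ w : H1 S, -mobilityForm σ φdag v w = ∫ x, u x * fn w x ∂S.vol

/-- `E(φ, U) = (ε² / 2) ‖∇φ‖² + ‖U‖² - B |Ω|`. -/
def energy {S : Setting d} (ε B : ℝ) (φ : H1 S) (U : L2 S) : ℝ :=
  ε ^ 2 / 2 * ‖grad φ‖ ^ 2 + ‖U‖ ^ 2 - B * volume.real S.carrier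

/-- `‖√M(φ†) ∇μ‖²`. -/
def dissipation {S : Setting d} (σ : ℝ) (φdag : EuclideanSpace ℝ (Fin d) → ℝ) (μ : H1 S) : ℝ :=
  ∫ x, ‖Real.sqrt (mobility σ (φdag x)) • grad μ x‖ ^ 2 ∂S.vol

end CahnHilliard

end

open CahnHilliard

/-!
The scheme is a linear elliptic problem in Hilbert space; three facts of analysis make it one.

* *Coefficients.* The mobility lies between `σ / 8` and `1 / 4` (`mobility_bounds`). The function
  `H = F' / √(F + B)` is bounded (`abs_hFun_le`) without any study of the growth of `F`: since
  `F'' ≤ 2 / σ` and `F + B > 0`, Taylor's formula gives `F'² ≤ (4 / σ) (F + B)`. Multiplication by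
  these coefficients is therefore continuous on `L²`.
* *Poincaré's inequality* (`exists_norm_fn_sq_le`). Testing with smooth compactly supported
  functions and differentiating along the translation shows
  `∫_A |u(x + h) - u(x)|² dx ≤ |h|² ‖∇u‖²` when the segments from `A` to `A + h` lie in `Ω`
  (`lintegral_translate_sub_sq_le`). Averaging over `h` bounds the oscillation
  `∫_B ∫_A |u(x) - u(y)|² dx dy` for `A = B` a convex open set, such as a ball or the periodic box.
  For a fixed ball `B`, the property that this oscillation is controlled by `‖∇u‖²` passes from `A`
  to overlapping balls, hence to a neighbourhood of each point of the connected set `Ω`; by a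
  translation along the vector of the segment property, it reaches the part in `Ω` of a
  neighbourhood of each boundary point; and by compactness of the closure it holds for `A = Ω`. No
  compact embedding is needed.
* *Structure of `H¹`.* The space is complete, contains the constants (in the periodic case by the
  divergence theorem), and its elements determine their weak gradients. In the periodic case
  the last fact and Poincaré's inequality use that functions with compact support in the box extend
  periodically.

The rest is linear algebra with the Lax–Milgram theorem (`IsWeakModel`). The operator `Δ⁻¹` exists
because `(M ∇u, ∇u)` is coercive on `V`. Since `(-Δ⁻¹ ψ, χ) = (M ∇Δ⁻¹ψ, ∇Δ⁻¹χ)`, the operator `A` is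
symmetric and `(A ψ, ψ) ≥ (ε² / 2) ‖∇ψ‖²`, so `A ψ = b` is uniquely solvable. The linear system for
`(φ, μ)` is this equation (`IsWeakModel.exists_step_iff`): tested with constants, its first equation
says that `φ` has the mean of `φⁿ` and its second one fixes the mean of `μ`; the remaining part of
`μ` is `Δ⁻¹ ((φ - φⁿ) / δt)`. Finally `Uⁿ⁺¹` is eliminated pointwise (`isStep_iff`), and the energy
law results from testing with `μ` and with `φⁿ⁺¹ - φⁿ` (`energy_law`).
-/

namespace CahnHilliard

variable {d : ℕ}

/-! ### Bounds on the coefficients -/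

theorem mobility_bounds {σ : ℝ} (hσ : 0 < σ) (hσ' : σ < 1 / 2) (s : ℝ) :
    σ / 8 ≤ mobility σ s ∧ mobility σ s ≤ 1 / 4 := by
  unfold mobility
  split_ifs with h
  · have h1 : (2 * s - 1) ^ 2 ≤ 1 := by nlinarith [h.1, h.2]
    have h2 : 0 ≤ (2 * s - 1) ^ 2 := sq_nonneg _
    constructor <;> nlinarith
  · have h1 : 0 ≤ (2 * s - 1) ^ 2 - 1 := by
      rcases not_and_or.1 h with h | h <;> nlinarith [not_le.1 h]
    have h2 : Real.exp (-2 * (1 - σ) * ((2 * s - 1) ^ 2 - 1) / σ) ≤ 1 := by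
      rw [Real.exp_le_one_iff]
      refine div_nonpos_of_nonpos_of_nonneg ?_ hσ.le
      nlinarith
    have h3 := Real.exp_pos (-2 * (1 - σ) * ((2 * s - 1) ^ 2 - 1) / σ)
    constructor <;> nlinarith

theorem measurable_mobility (σ : ℝ) : Measurable (mobility σ) := by
  unfold mobility
  refine Measurable.ite measurableSet_Icc ?_ ?_ <;> fun_prop

theorem measurable_potential (σ θ : ℝ) : Measurable (potential σ θ) := by
  unfold potential
  refine Measurable.ite measurableSet_Ici ?_ (Measurable.ite measurableSet_Ici ?_ ?_) <;> fun_prop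

theorem measurable_hFun (σ θ B : ℝ) : Measurable (hFun σ θ B) := by
  unfold hFun
  have := measurable_potential σ θ
  have := measurable_deriv (potential σ θ)
  fun_prop

/-- If `L s² / 2 - G s` is convex (expressed by monotonicity of its derivative) and `G` is
positive, then Taylor's inequality at the minimizing step `-G' / L` bounds `G'` by `√(2 L G)`. -/
theorem sq_deriv_le_of_monotone {G G' : ℝ → ℝ} {L : ℝ} (hL : 0 < L)
    (hG : ∀ s, HasDerivAt G (G' s) s) (hmono : Monotone fun s => L * s - G' s)
    (hpos : ∀ s, 0 < G s) (s : ℝ) : G' s ^ 2 ≤ 2 * L * G s := by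
  have hder : ∀ t, HasDerivAt (fun t => L * t ^ 2 / 2 - G t) (L * t - G' t) t := by
    intro t
    have h := (((hasDerivAt_pow 2 t).const_mul L).div_const 2).sub (hG t)
    convert! h using 1
    simp; ring
  have hconv : ConvexOn ℝ Set.univ fun t => L * t ^ 2 / 2 - G t := by
    refine Monotone.convexOn_univ_of_deriv (fun t => (hder t).differentiableAt) ?_
    have : deriv (fun t => L * t ^ 2 / 2 - G t) = fun t => L * t - G' t :=
      funext fun t => (hder t).deriv
    rwa [this]
  have key : ∀ t, (L * s ^ 2 / 2 - G s) + (L * s - G' s) * (t - s) ≤ L * t ^ 2 / 2 - G t := by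
    intro t
    rcases lt_trichotomy s t with h | h | h
    · have := hconv.le_slope_of_hasDerivAt (Set.mem_univ s) (Set.mem_univ t) h (hder s)
      rw [slope_def_field, le_div_iff₀ (by linarith)] at this
      linarith
    · subst h; simp
    · have := hconv.slope_le_of_hasDerivAt (Set.mem_univ t) (Set.mem_univ s) h (hder s)
      rw [slope_def_field, div_le_iff₀ (by linarith)] at this
      linarith
  have h1 := key (s - G' s / L)
  have h2 := hpos (s - G' s / L)
  have h3 : G' s / L * L = G' s := div_mul_cancel₀ _ hL.ne'
  set q := G' s / L
  rw [← h3]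
  rw [← h3] at h1
  nlinarith

/-- The derivative of `potential σ θ`, in closed form. -/
noncomputable def potentialDeriv (σ θ s : ℝ) : ℝ :=
  if 1 - σ ≤ s then Real.log s + 1 - (1 - s) / σ - Real.log σ + θ * (1 - 2 * s)
  else if σ ≤ s then Real.log s - Real.log (1 - s) + θ * (1 - 2 * s)
  else -Real.log (1 - s) - 1 + s / σ + Real.log σ + θ * (1 - 2 * s)

theorem hasDerivAt_mul_log_one_sub {s : ℝ} (hs : s < 1) :
    HasDerivAt (fun s : ℝ => (1 - s) * Real.log (1 - s)) (-Real.log (1 - s) - 1) s := by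
  have h := (Real.hasDerivAt_mul_log (x := 1 - s) (by linarith)).comp s
    ((hasDerivAt_id s).const_sub 1)
  convert! h using 1
  ring

theorem hasDerivAt_mul_one_sub_sq (θ s : ℝ) :
    HasDerivAt (fun s : ℝ => θ * (s - s ^ 2)) (θ * (1 - 2 * s)) s := by
  have h := ((hasDerivAt_id s).sub (hasDerivAt_pow 2 s)).const_mul θ
  convert! h using 1
  simp

/-- A function given by two formulas that agree, with their derivatives, at the breakpoint. -/
theorem hasDerivAt_ite_le {f g f' g' : ℝ → ℝ} {c s : ℝ}
    (hf : c ≤ s → HasDerivAt f (f' s) s) (hg : s ≤ c → HasDerivAt g (g' s) s)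
    (hval : f c = g c) (hder : f' c = g' c) :
    HasDerivAt (fun s => if c ≤ s then f s else g s) (if c ≤ s then f' s else g' s) s := by
  rcases lt_trichotomy s c with h | h | h
  · rw [if_neg (not_le.2 h)]
    refine (hg h.le).congr_of_eventuallyEq ?_
    filter_upwards [gt_mem_nhds h] with x hx using if_neg (not_le.2 hx)
  · subst h
    rw [if_pos le_rfl, ← hasDerivWithinAt_univ, ← Set.Iic_union_Ici (a := s)]
    refine HasDerivWithinAt.union ?_ ?_
    · have h := (hg le_rfl).hasDerivWithinAt (s := Set.Iic s)
      rw [← hder] at h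
      refine h.congr (fun x hx => ?_) ?_
      · rcases (Set.mem_Iic.1 hx).lt_or_eq with hx | rfl
        · exact if_neg (not_le.2 hx)
        · rw [if_pos le_rfl, hval]
      · rw [if_pos le_rfl, hval]
    · exact (hf le_rfl).hasDerivWithinAt.congr (fun x hx => if_pos hx) (if_pos le_rfl)
  · rw [if_pos h.le]
    refine (hf h.le).congr_of_eventuallyEq ?_
    filter_upwards [lt_mem_nhds h] with x hx using if_pos (le_of_lt hx)

theorem hasDerivAt_potential {σ : ℝ} (hσ : 0 < σ) (hσ' : σ < 1 / 2) (θ s : ℝ) :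
    HasDerivAt (potential σ θ) (potentialDeriv σ θ s) s := by
  have hup : ∀ s : ℝ, 0 < s → HasDerivAt (fun s : ℝ => s * Real.log s + (1 - s) ^ 2 / (2 * σ) +
      (1 - s) * Real.log σ - σ / 2 + θ * (s - s ^ 2))
      (Real.log s + 1 - (1 - s) / σ - Real.log σ + θ * (1 - 2 * s)) s := by
    intro s hs
    have h := ((((Real.hasDerivAt_mul_log hs.ne').add
      ((((hasDerivAt_id s).const_sub 1).pow 2).div_const (2 * σ))).add
      (((hasDerivAt_id s).const_sub 1).mul_const (Real.log σ))).sub_const (σ / 2)).add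
      (hasDerivAt_mul_one_sub_sq θ s)
    convert! h using 1
    simp
    field_simp
    ring
  have hmid : ∀ s : ℝ, 0 < s → s < 1 → HasDerivAt (fun s : ℝ => s * Real.log s +
      (1 - s) * Real.log (1 - s) + θ * (s - s ^ 2))
      (Real.log s - Real.log (1 - s) + θ * (1 - 2 * s)) s := by
    intro s hs hs1
    have h := ((Real.hasDerivAt_mul_log hs.ne').add (hasDerivAt_mul_log_one_sub hs1)).add
      (hasDerivAt_mul_one_sub_sq θ s)
    convert! h using 1
    ring
  have hlow : ∀ s : ℝ, s < 1 → HasDerivAt (fun s : ℝ => (1 - s) * Real.log (1 - s) +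
      s ^ 2 / (2 * σ) + s * Real.log σ - σ / 2 + θ * (s - s ^ 2))
      (-Real.log (1 - s) - 1 + s / σ + Real.log σ + θ * (1 - 2 * s)) s := by
    intro s hs1
    have h := ((((hasDerivAt_mul_log_one_sub hs1).add
      (((hasDerivAt_id s).pow 2).div_const (2 * σ))).add
      ((hasDerivAt_id s).mul_const (Real.log σ))).sub_const (σ / 2)).add
      (hasDerivAt_mul_one_sub_sq θ s)
    convert! h using 1
    simp
    field_simp
  have h1 : ¬ (1 - σ ≤ σ) := by linarith
  refine hasDerivAt_ite_le (f' := fun s => Real.log s + 1 - (1 - s) / σ - Real.log σ +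
      θ * (1 - 2 * s))
    (g' := fun s => if σ ≤ s then Real.log s - Real.log (1 - s) + θ * (1 - 2 * s)
      else -Real.log (1 - s) - 1 + s / σ + Real.log σ + θ * (1 - 2 * s))
    (fun h => hup s (by linarith)) (fun h => ?_) ?_ ?_
  · refine hasDerivAt_ite_le (f' := fun s => Real.log s - Real.log (1 - s) + θ * (1 - 2 * s))
      (g' := fun s => -Real.log (1 - s) - 1 + s / σ + Real.log σ + θ * (1 - 2 * s))
      (fun h' => hmid s (by linarith) (by linarith)) (fun h' => hlow s (by linarith)) ?_ ?_
    · field_simp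
      ring
    · field_simp
      ring
  · simp only [if_pos (show σ ≤ 1 - σ by linarith)]
    rw [sub_sub_cancel]
    field_simp
    ring
  · simp only [if_pos (show σ ≤ 1 - σ by linarith)]
    rw [sub_sub_cancel]
    field_simp
    ring

theorem log_sub_log_le {σ x y : ℝ} (hσ : 0 < σ) (hx : σ ≤ x) (hxy : x ≤ y) :
    Real.log y - Real.log x ≤ (y - x) / σ := by
  have hx0 : 0 < x := hσ.trans_le hx
  rw [← Real.log_div (by linarith) hx0.ne']
  calc Real.log (y / x) ≤ y / x - 1 := Real.log_le_sub_one_of_pos (div_pos (by linarith) hx0)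
    _ = (y - x) / x := by rw [sub_div, div_self hx0.ne']
    _ ≤ (y - x) / σ := div_le_div_of_nonneg_left (by linarith) hσ hx

/-- The bound `F'' ≤ 2 / σ`, expressed through the monotonicity of `2 s / σ - F'(s)`; it is checked
on the three pieces, where the logarithms have slope at most `1 / σ`. -/
theorem monotone_sub_potentialDeriv {σ θ : ℝ} (hσ : 0 < σ) (hσ' : σ < 1 / 2) (hθ : 1 < θ) :
    Monotone fun s => 2 / σ * s - potentialDeriv σ θ s := by
  have hi : ∀ s, 2 / σ * s = 2 * (s / σ) := fun s => by ring
  have hd : ∀ s, (1 - s) / σ = 1 / σ - s / σ := fun s => sub_div _ _ _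
  have hs : ∀ x y : ℝ, (x - y) / σ = x / σ - y / σ := fun x y => sub_div _ _ _
  have hA : MonotoneOn (fun s => 2 / σ * s - potentialDeriv σ θ s) (Set.Iic σ) := by
    have : ∀ s ≤ σ, potentialDeriv σ θ s =
        -Real.log (1 - s) - 1 + s / σ + Real.log σ + θ * (1 - 2 * s) := by
      intro s hs
      unfold potentialDeriv
      rw [if_neg (by linarith)]
      split_ifs with h
      · obtain rfl : s = σ := le_antisymm hs h
        field_simp
        ring
      · rfl
    intro x hx y hy hxy
    simp only [this x hx, this y hy]
    have := log_sub_log_le (x := 1 - y) (y := 1 - x) hσ (by linarith [Set.mem_Iic.1 hy])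
      (by linarith)
    rw [hs, hd, hd] at this
    rw [hi, hi]
    have h3 : x / σ ≤ y / σ := by gcongr
    nlinarith
  have hB : MonotoneOn (fun s => 2 / σ * s - potentialDeriv σ θ s) (Set.Icc σ (1 - σ)) := by
    have : ∀ s, σ ≤ s → s ≤ 1 - σ → potentialDeriv σ θ s =
        Real.log s - Real.log (1 - s) + θ * (1 - 2 * s) := by
      intro s hs hs'
      unfold potentialDeriv
      split_ifs with h
      · obtain rfl : s = 1 - σ := le_antisymm hs' h
        rw [sub_sub_cancel]
        field_simp
        ring
      · rfl
    intro x hx y hy hxy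
    simp only [this x hx.1 hx.2, this y hy.1 hy.2]
    have h1 := log_sub_log_le (x := 1 - y) (y := 1 - x) hσ (by linarith [hy.2]) (by linarith)
    have h2 := log_sub_log_le hσ hx.1 hxy
    rw [hs, hd, hd] at h1
    rw [hs] at h2
    rw [hi, hi]
    nlinarith
  have hC : MonotoneOn (fun s => 2 / σ * s - potentialDeriv σ θ s) (Set.Ici (1 - σ)) := by
    intro x hx y hy hxy
    simp only [potentialDeriv, if_pos (Set.mem_Ici.1 hx), if_pos (Set.mem_Ici.1 hy)]
    have h2 := log_sub_log_le hσ (by linarith [Set.mem_Ici.1 hx]) hxy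
    rw [hs] at h2
    rw [hi, hi, hd, hd]
    nlinarith
  have hAB := hA.union_right hB (c := σ) isGreatest_Iic (isLeast_Icc (by linarith))
  rw [Set.Iic_union_Icc_eq_Iic (by linarith)] at hAB
  have hABC := hAB.union_right hC (c := 1 - σ) isGreatest_Iic isLeast_Ici
  rwa [Set.Iic_union_Ici, monotoneOn_univ] at hABC

/-- `H` is bounded as soon as `F + B` is positive, because `F''` is bounded above. -/
theorem abs_hFun_le {σ θ B : ℝ} (hσ : 0 < σ) (hσ' : σ < 1 / 2) (hθ : 1 < θ)
    (hB : ∀ s : ℝ, 0 < potential σ θ s + B) (s : ℝ) :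
    |hFun σ θ B s| ≤ Real.sqrt (2 * (2 / σ)) := by
  have h := sq_deriv_le_of_monotone (G := fun s => potential σ θ s + B)
    (G' := potentialDeriv σ θ) (L := 2 / σ) (by positivity)
    (fun s => (hasDerivAt_potential hσ hσ' θ s).add_const B)
    (monotone_sub_potentialDeriv hσ hσ' hθ) hB s
  unfold hFun
  rw [(hasDerivAt_potential hσ hσ' θ s).deriv, abs_div, abs_of_nonneg (Real.sqrt_nonneg _),
    div_le_iff₀ (Real.sqrt_pos.2 (hB s)), ← Real.sqrt_mul (by positivity)]
  exact Real.abs_le_sqrt h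

/-! ### Test functions -/

theorem Setting.isOpen_carrier (S : Setting d) : IsOpen S.carrier := by
  cases S with
  | periodic a b hab =>
    have : (Setting.periodic a b hab).carrier = ⋂ i, {x | a i < x i ∧ x i < b i} := by
      ext x; simp [Setting.carrier]
    rw [this]
    refine isOpen_iInter_of_finite fun i => ?_
    have hc : Continuous fun x : EuclideanSpace ℝ (Fin d) => x i := by fun_prop
    exact (isOpen_lt continuous_const hc).inter (isOpen_lt hc continuous_const)
  | noFlux Ω hΩ => exact hΩ.isOpen

theorem Setting.nonempty_carrier (S : Setting d) : S.carrier.Nonempty := by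
  cases S with
  | periodic a b hab =>
    exact ⟨WithLp.toLp 2 fun i => (a i + b i) / 2, fun i => by
      constructor <;> simp <;> linarith [hab i]⟩
  | noFlux Ω hΩ => exact hΩ.isConnected.nonempty

/-- Smooth functions with compact support in `Ω`. -/
structure IsInteriorTest (Ω : Set (EuclideanSpace ℝ (Fin d)))
    (η : EuclideanSpace ℝ (Fin d) → ℝ) : Prop where
  contDiff : ContDiff ℝ ∞ η
  hasCompactSupport : HasCompactSupport η
  tsupport_subset : tsupport η ⊆ Ω

namespace IsInteriorTest

variable {Ω : Set (EuclideanSpace ℝ (Fin d))} {η ζ : EuclideanSpace ℝ (Fin d) → ℝ}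

theorem eq_zero (hη : IsInteriorTest Ω η) {x : EuclideanSpace ℝ (Fin d)} (hx : x ∉ Ω) : η x = 0 :=
  image_eq_zero_of_notMem_tsupport fun h => hx (hη.tsupport_subset h)

theorem fderiv_eq_zero (hη : IsInteriorTest Ω η) {x : EuclideanSpace ℝ (Fin d)} (hx : x ∉ Ω) :
    fderiv ℝ η x = 0 := by
  by_contra h
  exact hx (hη.tsupport_subset (support_fderiv_subset ℝ h))

theorem memLp (hη : IsInteriorTest Ω η) (μ : Measure (EuclideanSpace ℝ (Fin d)))
    [IsFiniteMeasureOnCompacts μ] : MemLp η 2 μ :=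
  hη.contDiff.continuous.memLp_of_hasCompactSupport hη.hasCompactSupport

theorem add (hη : IsInteriorTest Ω η) (hζ : IsInteriorTest Ω ζ) :
    IsInteriorTest Ω fun x => η x + ζ x :=
  ⟨hη.contDiff.add hζ.contDiff, hη.hasCompactSupport.add hζ.hasCompactSupport,
    (tsupport_add η ζ).trans (Set.union_subset hη.tsupport_subset hζ.tsupport_subset)⟩

theorem const_mul (hη : IsInteriorTest Ω η) (c : ℝ) : IsInteriorTest Ω fun x => c * η x :=
  ⟨contDiff_const.mul hη.contDiff, hη.hasCompactSupport.mul_left,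
    tsupport_mul_subset_right.trans hη.tsupport_subset⟩

theorem translate (hη : IsInteriorTest Ω η) (v : EuclideanSpace ℝ (Fin d))
    {Ω' : Set (EuclideanSpace ℝ (Fin d))} (h : ∀ x ∈ Ω, x + v ∈ Ω') :
    IsInteriorTest Ω' fun x => η (x - v) := by
  refine ⟨hη.contDiff.comp (contDiff_id.sub contDiff_const),
    hη.hasCompactSupport.comp_homeomorph (Homeomorph.subRight v), ?_⟩
  have h1 := tsupport_comp_eq_preimage η (Homeomorph.subRight v)
  intro x hx
  have h2 : x ∈ Homeomorph.subRight v ⁻¹' tsupport η := h1 ▸ hx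
  simpa using h _ (hη.tsupport_subset h2)

end IsInteriorTest

/-- A smooth function with compact support in a box has a smooth periodic extension. -/
theorem exists_periodic_eqOn (a b : Fin d → ℝ) (hab : ∀ i, a i < b i)
    {η : EuclideanSpace ℝ (Fin d) → ℝ}
    (hη : IsInteriorTest (Setting.periodic a b hab).carrier η) :
    ∃ ζ, (Setting.periodic a b hab).IsTest ζ ∧
      Set.EqOn ζ η (Setting.periodic a b hab).carrier := by
  let v : (Fin d → ℤ) → EuclideanSpace ℝ (Fin d) :=
    fun k => WithLp.toLp 2 fun i => k i * (b i - a i)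
  have hL : ∀ i, 0 < b i - a i := fun i => sub_pos.2 (hab i)
  have hsupp : ∀ k x, η (x + v k) ≠ 0 →
      ∀ i, a i < x i + k i * (b i - a i) ∧ x i + k i * (b i - a i) < b i := by
    intro k x h
    by_contra hc
    refine h (hη.eq_zero fun hx => hc fun i => ?_)
    simpa [v] using hx i
  -- Near `x` only the finitely many translates `k` with `x + v k` close to the box matter.
  have hfin : LocallyFinite fun k => Function.support fun x => η (x + v k) := by
    intro x
    refine ⟨Metric.ball x 1, Metric.ball_mem_nhds x one_pos, ?_⟩
    refine (Set.finite_Icc (fun i => ⌊(a i - x i - 1) / (b i - a i)⌋)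
      fun i => ⌈(b i - x i + 1) / (b i - a i)⌉).subset ?_
    rintro k ⟨z, hz, hzx⟩
    have hzi : ∀ i, |z i - x i| < 1 := fun i => by
      have h1 := PiLp.norm_apply_le (z - x) i
      have h2 : ‖z - x‖ < 1 := mem_ball_iff_norm.1 hzx
      simpa using h1.trans_lt h2
    constructor
    · intro i
      have h := (hsupp k z hz i).1
      have h' := abs_lt.1 (hzi i)
      have : (a i - x i - 1) / (b i - a i) < k i := by
        rw [div_lt_iff₀ (hL i)]
        linarith
      exact_mod_cast (Int.floor_le _).trans this.le
    · intro i
      have h := (hsupp k z hz i).2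
      have h' := abs_lt.1 (hzi i)
      have : (k i : ℝ) < (b i - x i + 1) / (b i - a i) := by
        rw [lt_div_iff₀ (hL i)]
        linarith
      exact_mod_cast this.le.trans (Int.le_ceil _)
  refine ⟨fun x => ∑ᶠ k, η (x + v k), ⟨?_, ?_⟩, ?_⟩
  · rw [contDiff_iff_contDiffAt]
    intro x
    obtain ⟨I, n, hn, -, hI⟩ := hfin.exists_finset_nhds_support_subset
      (U := fun _ => Set.univ) (fun _ => Set.subset_univ _) (fun _ => isOpen_univ) x
    have h : ContDiffAt ℝ ∞ (fun x => ∑ k ∈ I, η (x + v k)) x :=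
      ContDiffAt.sum fun k _ =>
        (hη.contDiff.comp (contDiff_id.add contDiff_const)).contDiffAt
    refine h.congr_of_eventuallyEq ?_
    filter_upwards [hn] with z hz using finsum_eq_sum_of_support_subset _ (hI z hz)
  · intro i x
    change ∑ᶠ k, η (x + EuclideanSpace.single i (b i - a i) + v k) = ∑ᶠ k, η (x + v k)
    rw [← finsum_comp_equiv (Equiv.addRight (Pi.single i 1 : Fin d → ℤ))
      (f := fun k => η (x + v k))]
    refine finsum_congr fun k => congrArg η ?_
    ext j
    by_cases hj : j = i
    · subst hj
      simp [v]
      ring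
    · simp [v, hj]
  · intro x hx
    change ∑ᶠ k, η (x + v k) = η x
    -- Translates of the open box by distinct periods are disjoint.
    rw [finsum_eq_single _ 0]
    · congr 1
      ext i
      simp [v]
    · intro k hk
      by_contra hne
      refine hk (funext fun i => ?_)
      have h1 := hsupp k x hne i
      have h2 : -1 * (b i - a i) < k i * (b i - a i) := by linarith [(hx i).1, (hx i).2]
      have h3 : k i * (b i - a i) < 1 * (b i - a i) := by linarith [(hx i).1, (hx i).2]
      have h4 := lt_of_mul_lt_mul_right h2 (hL i).le
      have h5 := lt_of_mul_lt_mul_right h3 (hL i).le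
      have h6 : -1 < k i := by exact_mod_cast h4
      have h7 : k i < 1 := by exact_mod_cast h5
      simp
      omega

theorem exists_isTest_eqOn (S : Setting d) {η : EuclideanSpace ℝ (Fin d) → ℝ}
    (hη : IsInteriorTest S.carrier η) : ∃ ζ, S.IsTest ζ ∧ Set.EqOn ζ η S.carrier := by
  cases S with
  | periodic a b hab => exact exists_periodic_eqOn a b hab hη
  | noFlux Ω hΩ =>
    exact ⟨η, ⟨hη.contDiff, hη.hasCompactSupport, hη.tsupport_subset⟩, fun _ _ => rfl⟩

/-- Under both kinds of boundary conditions a weak gradient can be tested with smooth functions of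
compact support in `Ω`, in any direction. -/
theorem integral_mul_fderiv_eq (S : Setting d) (p : H1 S) {η : EuclideanSpace ℝ (Fin d) → ℝ}
    (hη : IsInteriorTest S.carrier η) (h : EuclideanSpace ℝ (Fin d)) :
    ∫ x, fn p x * fderiv ℝ η x h ∂S.vol = -∫ x, inner ℝ (grad p x) h * η x ∂S.vol := by
  obtain ⟨ζ, hζ, hζη⟩ := exists_isTest_eqOn S hη
  have hmem : ∀ᵐ x ∂S.vol, x ∈ S.carrier := ae_restrict_mem S.isOpen_carrier.measurableSet
  have hD : ∀ x ∈ S.carrier, fderiv ℝ ζ x = fderiv ℝ η x := fun x hx =>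
    (hζη.eventuallyEq_of_mem (S.isOpen_carrier.mem_nhds hx)).fderiv_eq
  have hh : h = ∑ i, h i • EuclideanSpace.single i (1 : ℝ) := by
    ext j; simp [Finset.sum_apply, Pi.single_apply]
  have e1 : ∫ x, fn p x * fderiv ℝ η x h ∂S.vol =
      ∫ x, ∑ i, h i * (fn p x * fderiv ℝ ζ x (EuclideanSpace.single i 1)) ∂S.vol := by
    refine integral_congr_ae ?_
    filter_upwards [hmem] with x hx
    rw [hD x hx]
    conv_lhs => rw [hh]
    rw [map_sum, Finset.mul_sum]
    refine Finset.sum_congr rfl fun i _ => ?_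
    rw [map_smul, smul_eq_mul]
    ring
  have e2 : ∫ x, inner ℝ (grad p x) h * η x ∂S.vol =
      ∫ x, ∑ i, h i * (grad p x i * ζ x) ∂S.vol := by
    refine integral_congr_ae ?_
    filter_upwards [hmem] with x hx
    rw [hζη hx, PiLp.inner_apply, Finset.sum_mul]
    refine Finset.sum_congr rfl fun i _ => ?_
    simp only [RCLike.inner_apply, conj_trivial]
    ring
  rw [e1, e2, integral_finsetSum, integral_finsetSum, ← Finset.sum_neg_distrib]
  · refine Finset.sum_congr rfl fun i _ => ?_
    rw [integral_const_mul, integral_const_mul, ← mul_neg]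
    congr 1
    exact p.2 ζ hζ i
  · exact fun i _ => (S.integrable_mul (memLp_coord (Lp.memLp _) i) hζ.continuous).const_mul _
  · exact fun i _ => (S.integrable_mul (Lp.memLp _) (hζ.continuous_fderiv _)).const_mul _

/-! ### The translation estimate -/

/-- Duality in `L²(A)` against smooth functions with compact support in the open set `A`. -/
theorem norm_le_of_forall_interiorTest {A : Set (EuclideanSpace ℝ (Fin d))} (hA : IsOpen A)
    (F : Lp ℝ 2 (volume.restrict A)) {C : ℝ} (hC : 0 ≤ C)
    (h : ∀ η, IsInteriorTest A η →
      ∫ x in A, F x * η x ≤ C * (eLpNorm η 2 (volume.restrict A)).toReal) :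
    ‖F‖ ≤ C := by
  -- The classes of test functions form a subspace; it is dense, as its orthogonal complement
  -- vanishes by the fundamental lemma of the calculus of variations.
  let D : Submodule ℝ (Lp ℝ 2 (volume.restrict A)) :=
    { carrier := {f | ∃ η, IsInteriorTest A η ∧ f =ᵐ[volume.restrict A] η}
      zero_mem' := ⟨fun _ => 0, ⟨contDiff_const, HasCompactSupport.zero, by simp [tsupport]⟩,
        Lp.coeFn_zero _ _ _⟩
      add_mem' := by
        rintro f g ⟨η, hη, hf⟩ ⟨ζ, hζ, hg⟩
        refine ⟨_, hη.add hζ, ?_⟩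
        filter_upwards [hf, hg, Lp.coeFn_add f g] with x h1 h2 h3
        rw [h3, Pi.add_apply, h1, h2]
      smul_mem' := by
        rintro c f ⟨η, hη, hf⟩
        refine ⟨_, hη.const_mul c, ?_⟩
        filter_upwards [hf, Lp.coeFn_smul c f] with x h1 h2
        rw [h2, Pi.smul_apply, h1, smul_eq_mul] }
  have hdense : D.topologicalClosure = ⊤ := by
    rw [Submodule.topologicalClosure_eq_top_iff, Submodule.eq_bot_iff]
    intro g hg
    have hloc : LocallyIntegrableOn g A volume := by
      have h1 : LocallyIntegrable g (volume.restrict A) :=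
        (Lp.memLp g).locallyIntegrable (by norm_num)
      exact fun x hx => by
        obtain ⟨U, hU, hUi⟩ := h1 x
        refine ⟨U ∩ A, inter_mem (mem_nhdsWithin_of_mem_nhds hU) self_mem_nhdsWithin, ?_⟩
        rwa [IntegrableOn, Measure.restrict_restrict₀' hA.measurableSet.nullMeasurableSet] at hUi
    have h0 := hA.ae_eq_zero_of_integral_contDiff_smul_eq_zero hloc fun η h1 h2 h3 => by
      have hη : IsInteriorTest A η := ⟨h1, h2, h3⟩
      have h4 := hg (hη.memLp _).toLp ⟨η, hη, (hη.memLp _).coeFn_toLp⟩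
      rw [L2.inner_def] at h4
      rw [← setIntegral_eq_integral_of_forall_compl_eq_zero (s := A)
        fun x hx => by rw [hη.eq_zero hx, zero_smul], ← h4]
      refine integral_congr_ae ?_
      filter_upwards [(hη.memLp (volume.restrict A)).coeFn_toLp] with x hx
      rw [hx, RCLike.inner_apply, conj_trivial, smul_eq_mul, mul_comm]
    rw [Lp.eq_zero_iff_ae_eq_zero]
    exact (ae_restrict_iff' hA.measurableSet).2 h0
  have hclosed : IsClosed {f : Lp ℝ 2 (volume.restrict A) | inner ℝ F f ≤ C * ‖f‖} :=
    isClosed_le (by fun_prop) (by fun_prop)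
  have hsub : (D : Set (Lp ℝ 2 (volume.restrict A))) ⊆ {f | inner ℝ F f ≤ C * ‖f‖} := by
    rintro f ⟨η, hη, hf⟩
    have h1 := h η hη
    rw [← eLpNorm_congr_ae hf, ← Lp.norm_def] at h1
    refine le_trans (le_of_eq ?_) h1
    rw [L2.inner_def]
    refine integral_congr_ae ?_
    filter_upwards [hf] with x hx
    rw [hx, RCLike.inner_apply, conj_trivial, mul_comm]
  have hF : F ∈ D.topologicalClosure := hdense ▸ Submodule.mem_top
  have h2 : inner ℝ F F ≤ C * ‖F‖ := closure_minimal hsub hclosed hF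
  rw [real_inner_self_eq_norm_sq, sq] at h2
  rcases (norm_nonneg F).eq_or_lt with h3 | h3
  · rwa [← h3]
  · exact le_of_mul_le_mul_right h2 h3

/-- The directional derivative, bounded by Cauchy–Schwarz. -/
theorem norm_integral_mul_fderiv_le (S : Setting d) (p : H1 S)
    {η : EuclideanSpace ℝ (Fin d) → ℝ} (hη : IsInteriorTest S.carrier η)
    (h : EuclideanSpace ℝ (Fin d)) :
    ‖∫ x, fn p x * fderiv ℝ η x h ∂S.vol‖ ≤
      ‖h‖ * ‖grad p‖ * (eLpNorm η 2 S.vol).toReal := by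
  rw [integral_mul_fderiv_eq S p hη h, norm_neg]
  have hm : MemLp (fun x => η x • h) 2 S.vol :=
    (hη.contDiff.continuous.smul continuous_const).memLp_of_hasCompactSupport
      hη.hasCompactSupport.smul_right
  have e : ∫ x, inner ℝ (grad p x) h * η x ∂S.vol = inner ℝ (grad p) hm.toLp := by
    rw [L2.inner_def]
    refine integral_congr_ae ?_
    filter_upwards [hm.coeFn_toLp] with x hx
    rw [hx, inner_smul_right, mul_comm]
  rw [e]
  refine (norm_inner_le_norm _ _).trans ?_
  have hle : ‖hm.toLp‖ ≤ ‖h‖ * (eLpNorm η 2 S.vol).toReal := by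
    rw [Lp.norm_toLp]
    have h1 := eLpNorm_le_mul_eLpNorm_of_ae_le_mul (μ := S.vol) (f := fun x => η x • h) (g := η)
      (c := ‖h‖) (ae_of_all _ fun x => by rw [norm_smul, mul_comm]) 2
    have h2 := ENNReal.toReal_mono
      (ENNReal.mul_ne_top ENNReal.ofReal_ne_top (hη.memLp S.vol).eLpNorm_ne_top) h1
    rwa [ENNReal.toReal_mul, ENNReal.toReal_ofReal (norm_nonneg _)] at h2
  calc ‖grad p‖ * ‖hm.toLp‖ ≤ ‖grad p‖ * (‖h‖ * (eLpNorm η 2 S.vol).toReal) := by gcongr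
    _ = _ := by ring

/-- The difference of `u` and its translate, tested with `η`: as a function of `t`, the integral
of `u η(· - t h)` has a derivative controlled by `∇u`. -/
theorem norm_integral_mul_translate_sub_le (S : Setting d) (p : H1 S)
    {A : Set (EuclideanSpace ℝ (Fin d))} (h : EuclideanSpace ℝ (Fin d))
    (hAh : ∀ z ∈ A, ∀ t ∈ Set.Icc (0 : ℝ) 1, z + t • h ∈ S.carrier)
    {η : EuclideanSpace ℝ (Fin d) → ℝ} (hη : IsInteriorTest A η) :
    ‖(∫ x, fn p x * η (x - h) ∂S.vol) - ∫ x, fn p x * η x ∂S.vol‖ ≤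
      ‖h‖ * ‖grad p‖ * (eLpNorm η 2 (volume.restrict A)).toReal := by
  have hcd : ContDiff ℝ 1 η := hη.contDiff.of_le (by exact_mod_cast le_top)
  have hcont : Continuous η := hη.contDiff.continuous
  have hcontD : Continuous fun x => fderiv ℝ η x h :=
    (hcd.continuous_fderiv one_ne_zero).clm_apply continuous_const
  have hint : Integrable (fn p) S.vol := (Lp.memLp (fn p)).integrable (by norm_num)
  obtain ⟨K, hK⟩ := (hη.hasCompactSupport.fderiv (𝕜 := ℝ)).exists_bound_of_continuous
    (hcd.continuous_fderiv one_ne_zero)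
  have hder : ∀ t : ℝ, HasDerivAt (fun t : ℝ => ∫ x, fn p x * η (x - t • h) ∂S.vol)
      (∫ x, fn p x * -fderiv ℝ η (x - t • h) h ∂S.vol) t := by
    intro t
    have hm : ∀ s : ℝ, AEStronglyMeasurable (fun x => fn p x * η (x - s • h)) S.vol := fun s =>
      hint.1.mul (hcont.comp (by fun_prop)).aestronglyMeasurable
    refine (hasDerivAt_integral_of_dominated_loc_of_deriv_le (s := Set.univ) univ_mem
      (F' := fun t x => fn p x * -fderiv ℝ η (x - t • h) h)
      (bound := fun x => ‖fn p x‖ * (K * ‖h‖))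
      (Eventually.of_forall hm) (S.integrable_mul (Lp.memLp _) (hcont.comp (by fun_prop)))
      ?_ ?_ (hint.norm.mul_const _) ?_).2
    · exact hint.1.mul (hcontD.comp (by fun_prop :
        Continuous fun x : EuclideanSpace ℝ (Fin d) => x - t • h)).neg.aestronglyMeasurable
    · refine ae_of_all _ fun x s _ => ?_
      rw [norm_mul, norm_neg]
      gcongr
      exact (ContinuousLinearMap.le_opNorm _ _).trans (by gcongr; exact hK _)
    · refine ae_of_all _ fun x s _ => HasDerivAt.const_mul _ ?_
      have h1 : HasDerivAt (fun s : ℝ => x - s • h) (-h) s := by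
        simpa using ((hasDerivAt_id s).smul_const h).const_sub x
      have h2 := ((hcd.differentiable one_ne_zero) (x - s • h)).hasFDerivAt.comp_hasDerivAt s h1
      rw [map_neg] at h2
      exact h2
  -- For `t ∈ [0, 1)` the translate `η(· - t h)` is again a test function on `Ω`, by `hAh`.
  have hbound : ∀ t ∈ Set.Ico (0 : ℝ) 1, ‖∫ x, fn p x * -fderiv ℝ η (x - t • h) h ∂S.vol‖ ≤
      ‖h‖ * ‖grad p‖ * (eLpNorm η 2 (volume.restrict A)).toReal := by
    intro t ht
    have hηt : IsInteriorTest S.carrier fun x => η (x - t • h) :=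
      hη.translate (t • h) fun x hx => hAh x hx t (Set.Ico_subset_Icc_self ht)
    have h1 := norm_integral_mul_fderiv_le S p hηt h
    simp only [mul_neg, integral_neg, norm_neg]
    simp only [fderiv_comp_sub] at h1
    refine h1.trans ?_
    gcongr
    · exact (hη.memLp _).eLpNorm_ne_top
    · calc eLpNorm (fun x => η (x - t • h)) 2 S.vol
          ≤ eLpNorm (fun x => η (x - t • h)) 2 volume :=
          eLpNorm_mono_measure _ Measure.restrict_le_self
        _ = eLpNorm η 2 volume :=
          eLpNorm_comp_measurePreserving hcont.aestronglyMeasurable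
            (measurePreserving_sub_right volume (t • h))
        _ = eLpNorm η 2 (volume.restrict A) := by
          refine (eLpNorm_restrict_eq_of_support_subset ?_).symm
          exact fun x hx => by_contra fun hxA => hx (hη.eq_zero hxA)
  have := norm_image_sub_le_of_norm_deriv_le_segment_01'
    (fun t _ => (hder t).hasDerivWithinAt) hbound
  simpa using this

/-- The translation estimate: `u(· + h) - u` is bounded in `L²(A)` by `|h| ‖∇u‖` when the segments
from the points of `A` in direction `h` stay in `Ω`. -/
theorem lintegral_translate_sub_sq_le (S : Setting d) (p : H1 S)
    {A : Set (EuclideanSpace ℝ (Fin d))} (hA : IsOpen A) (h : EuclideanSpace ℝ (Fin d))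
    (hAh : ∀ z ∈ A, ∀ t ∈ Set.Icc (0 : ℝ) 1, z + t • h ∈ S.carrier) :
    ∫⁻ z in A, ‖fn p (z + h) - fn p z‖ₑ ^ 2 ≤ ENNReal.ofReal ((‖h‖ * ‖grad p‖) ^ 2) := by
  have hA0 : A ⊆ S.carrier := fun z hz => by simpa using hAh z hz 0 (by simp)
  have hA1 : A ⊆ (· + h) ⁻¹' S.carrier := fun z hz => by simpa using hAh z hz 1 (by simp)
  have hm0 : MemLp (fn p) 2 (volume.restrict A) :=
    (Lp.memLp (fn p)).mono_measure (Measure.restrict_mono hA0 le_rfl)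
  have hm1 : MemLp (fun z => fn p (z + h)) 2 (volume.restrict A) := by
    have h1 := (measurePreserving_add_right
      (volume : Measure (EuclideanSpace ℝ (Fin d))) h).restrict_preimage
      S.isOpen_carrier.measurableSet
    exact ((Lp.memLp (fn p)).comp_measurePreserving h1).mono_measure
      (Measure.restrict_mono hA1 le_rfl)
  have hm := hm1.sub hm0
  have key : ‖hm.toLp‖ ≤ ‖h‖ * ‖grad p‖ := by
    refine norm_le_of_forall_interiorTest hA _ (by positivity) fun η hη => ?_
    refine le_trans (le_trans (le_of_eq ?_) (le_abs_self _))
      (norm_integral_mul_translate_sub_le S p h hAh hη)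
    have hi0 : Integrable (fun x => fn p x * η x) (volume.restrict A) :=
      hm0.integrable_mul (hη.memLp _)
    have hi1 : Integrable (fun x => fn p (x + h) * η x) (volume.restrict A) :=
      hm1.integrable_mul (hη.memLp _)
    have e1 : ∫ x in A, (hm.toLp _) x * η x =
        (∫ x in A, fn p (x + h) * η x) - ∫ x in A, fn p x * η x := by
      rw [← integral_sub hi1 hi0]
      refine integral_congr_ae ?_
      filter_upwards [hm.coeFn_toLp] with x hx
      rw [hx, Pi.sub_apply, sub_mul]
    have e2 : ∫ x in A, fn p x * η x = ∫ x, fn p x * η x ∂S.vol := by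
      rw [setIntegral_eq_integral_of_forall_compl_eq_zero
          (fun x hx => by rw [hη.eq_zero hx, mul_zero]),
        setIntegral_eq_integral_of_forall_compl_eq_zero
          (fun x hx => by rw [hη.eq_zero fun hxA => hx (hA0 hxA), mul_zero])]
    have e3 : ∫ x in A, fn p (x + h) * η x = ∫ x, fn p x * η (x - h) ∂S.vol := by
      rw [setIntegral_eq_integral_of_forall_compl_eq_zero
          (fun x hx => by rw [hη.eq_zero hx, mul_zero]),
        setIntegral_eq_integral_of_forall_compl_eq_zero (fun x hx => by
          rw [hη.eq_zero fun hxA => hx (by simpa using hA1 hxA), mul_zero]),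
        ← integral_sub_right_eq_self _ h]
      simp
    rw [e1, e2, e3]
  rw [Lp.norm_toLp] at key
  have h2 : ∫⁻ z in A, ‖fn p (z + h) - fn p z‖ₑ ^ 2 =
      eLpNorm (fun z => fn p (z + h) - fn p z) 2 (volume.restrict A) ^ 2 := by
    rw [eLpNorm_eq_lintegral_rpow_enorm_toReal two_ne_zero (by norm_num),
      ← ENNReal.rpow_natCast, ← ENNReal.rpow_mul]
    simp
  rw [h2, ENNReal.ofReal_pow (by positivity)]
  gcongr
  exact ENNReal.le_ofReal_iff_toReal_le hm.eLpNorm_ne_top (by positivity) |>.2 key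

/-! ### The Poincaré inequality -/

theorem measurable_fn {S : Setting d} (p : H1 S) : Measurable (fn p) :=
  (Lp.stronglyMeasurable (fn p)).measurable

theorem enorm_sub_sq_le (a b c : ℝ) :
    ‖a - b‖ₑ ^ 2 ≤ 2 * ‖a - c‖ₑ ^ 2 + 2 * ‖c - b‖ₑ ^ 2 := by
  have h : (a - b) ^ 2 ≤ 2 * (a - c) ^ 2 + 2 * (c - b) ^ 2 := by
    nlinarith [sq_nonneg (a - c - (c - b))]
  have e : ∀ x : ℝ, ‖x‖ₑ ^ 2 = ENNReal.ofReal (x ^ 2) := fun x => by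
    rw [Real.enorm_eq_ofReal_abs, ← ENNReal.ofReal_pow (abs_nonneg x), sq_abs]
  rw [e, e, e, ← ENNReal.ofReal_ofNat 2, ← ENNReal.ofReal_mul (by norm_num),
    ← ENNReal.ofReal_mul (by norm_num), ← ENNReal.ofReal_add (by positivity) (by positivity)]
  exact ENNReal.ofReal_le_ofReal h

/-- The oscillation of `H¹` functions between `A` and `B` is controlled by the gradient on `Ω`:
`∫_B ∫_A |u(x) - u(y)|² dx dy ≤ C ‖∇u‖²`. -/
def IsLinked (S : Setting d) (A B : Set (EuclideanSpace ℝ (Fin d))) : Prop :=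
  ∃ C : ENNReal, C ≠ ⊤ ∧ ∀ p : H1 S,
    ∫⁻ y in B, ∫⁻ x in A, ‖fn p x - fn p y‖ₑ ^ 2 ≤ C * ENNReal.ofReal (‖grad p‖ ^ 2)

theorem IsLinked.mono {S : Setting d} {A A' B : Set (EuclideanSpace ℝ (Fin d))}
    (h : IsLinked S A B) (hA : A' ⊆ A) : IsLinked S A' B := by
  obtain ⟨C, hC, h⟩ := h
  refine ⟨C, hC, fun p => le_trans ?_ (h p)⟩
  exact lintegral_mono fun y => lintegral_mono_set hA

theorem isLinked_empty (S : Setting d) (B : Set (EuclideanSpace ℝ (Fin d))) :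
    IsLinked S ∅ B := ⟨0, by simp, fun p => by simp⟩

theorem IsLinked.union {S : Setting d} {A A' B : Set (EuclideanSpace ℝ (Fin d))}
    (h : IsLinked S A B) (h' : IsLinked S A' B) : IsLinked S (A ∪ A') B := by
  obtain ⟨C, hC, h⟩ := h
  obtain ⟨C', hC', h'⟩ := h'
  refine ⟨C + C', ENNReal.add_ne_top.2 ⟨hC, hC'⟩, fun p => ?_⟩
  have hu := measurable_fn p
  rw [add_mul]
  refine le_trans ?_ (add_le_add (h p) (h' p))
  rw [← lintegral_add_left]
  · exact lintegral_mono fun y => lintegral_union_le _ _ _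
  · exact Measurable.lintegral_prod_right' (f := fun z : _ × _ => ‖fn p z.2 - fn p z.1‖ₑ ^ 2)
      (by fun_prop)

/-- On convex open sets the oscillation is an average of translation differences. -/
theorem isLinked_of_convex (S : Setting d) {U : Set (EuclideanSpace ℝ (Fin d))} (hU : IsOpen U)
    (hconv : Convex ℝ U) (hUS : U ⊆ S.carrier) : IsLinked S U U := by
  obtain ⟨R, hR0, hR⟩ := (S.isBounded_carrier.subset hUS).subset_ball_lt 0 0
  refine ⟨volume (Metric.ball (0 : EuclideanSpace ℝ (Fin d)) (2 * R)) *
    ENNReal.ofReal ((2 * R) ^ 2), ENNReal.mul_ne_top measure_ball_lt_top.ne ENNReal.ofReal_ne_top,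
    fun p => ?_⟩
  have hu := measurable_fn p
  have hUm := hU.measurableSet
  let f : EuclideanSpace ℝ (Fin d) → EuclideanSpace ℝ (Fin d) → ENNReal := fun y x =>
    U.indicator 1 y * (U.indicator 1 x * ‖fn p x - fn p y‖ₑ ^ 2)
  have h1 : Measurable (U.indicator (1 : EuclideanSpace ℝ (Fin d) → ENNReal)) :=
    measurable_one.indicator hUm
  have hind : ∀ (y : EuclideanSpace ℝ (Fin d)) (c : ENNReal),
      U.indicator 1 y * c = U.indicator (fun _ => c) y := fun y c => by
    by_cases hy : y ∈ U <;> simp [hy]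
  have e1 : ∫⁻ y in U, ∫⁻ x in U, ‖fn p x - fn p y‖ₑ ^ 2 = ∫⁻ y, ∫⁻ x, f y x := by
    rw [← lintegral_indicator hUm]
    refine lintegral_congr fun y => ?_
    by_cases hy : y ∈ U
    · rw [Set.indicator_of_mem hy, ← lintegral_indicator hUm]
      refine lintegral_congr fun x => ?_
      by_cases hx : x ∈ U <;> simp [f, hx, hy]
    · simp [f, hy]
  -- Substitute `x = y + h`; only `|h| < 2 R` contributes, `R` being a bound for `U`.
  have e2 : ∫⁻ y, ∫⁻ x, f y x = ∫⁻ h, ∫⁻ y, f y (y + h) := by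
    rw [← lintegral_lintegral_swap (f := fun y h => f y (y + h))
      (Measurable.aemeasurable (by fun_prop))]
    exact lintegral_congr fun y =>
      (lintegral_add_left_eq_self (μ := volume) (fun x => f y x) y).symm
  rw [e1, e2]
  have hball : MeasurableSet (Metric.ball (0 : EuclideanSpace ℝ (Fin d)) (2 * R)) :=
    measurableSet_ball
  calc ∫⁻ h, ∫⁻ y, f y (y + h)
      ≤ ∫⁻ h, (Metric.ball (0 : EuclideanSpace ℝ (Fin d)) (2 * R)).indicator
          (fun _ => ENNReal.ofReal ((2 * R) ^ 2) * ENNReal.ofReal (‖grad p‖ ^ 2)) h := by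
        refine lintegral_mono fun h => ?_
        dsimp only
        have hA : IsOpen (U ∩ (fun y => y + h) ⁻¹' U) := hU.inter (hU.preimage (by fun_prop))
        have e3 : ∫⁻ y, f y (y + h) =
            ∫⁻ y in U ∩ (fun y => y + h) ⁻¹' U, ‖fn p (y + h) - fn p y‖ₑ ^ 2 := by
          rw [← lintegral_indicator hA.measurableSet]
          refine lintegral_congr fun y => ?_
          by_cases hy : y ∈ U <;> by_cases hy' : y + h ∈ U <;> simp [f, hy, hy', Set.indicator]
        rw [e3]
        by_cases hh : h ∈ Metric.ball (0 : EuclideanSpace ℝ (Fin d)) (2 * R)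
        · rw [Set.indicator_of_mem hh]
          refine (lintegral_translate_sub_sq_le S p hA h ?_).trans ?_
          · intro z hz t ht
            refine hUS ?_
            have := hconv hz.1 hz.2 (sub_nonneg.2 ht.2) ht.1 (by ring)
            convert this using 1
            module
          · rw [← ENNReal.ofReal_mul (by positivity)]
            refine ENNReal.ofReal_le_ofReal ?_
            rw [mul_pow]
            have : ‖h‖ ≤ 2 * R := (mem_ball_zero_iff.1 hh).le
            gcongr
        · have : U ∩ (fun y => y + h) ⁻¹' U = ∅ := by
            rw [Set.eq_empty_iff_forall_notMem]
            rintro y ⟨hy, hy'⟩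
            refine hh ?_
            have h1 := mem_ball_zero_iff.1 (hR hy)
            have h2 := mem_ball_zero_iff.1 (hR hy')
            rw [mem_ball_zero_iff]
            calc ‖h‖ = ‖(y + h) - y‖ := by rw [add_sub_cancel_left]
              _ ≤ ‖y + h‖ + ‖y‖ := norm_sub_le _ _
              _ < 2 * R := by linarith
          rw [this]
          simp
    _ = _ := by
      rw [lintegral_indicator hball, setLIntegral_const]
      ring

/-- Linking is passed on through overlaps of positive measure. -/
theorem IsLinked.trans {S : Setting d} {A B U : Set (EuclideanSpace ℝ (Fin d))}
    (hAB : IsLinked S A B) (hU : IsLinked S U U)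
    (hpos : volume (A ∩ U) ≠ 0) (hB : volume B ≠ ⊤) (hUt : volume U ≠ ⊤) : IsLinked S U B := by
  obtain ⟨C, hC, h⟩ := hAB
  obtain ⟨C', hC', h'⟩ := hU
  have hW : volume (A ∩ U) ≠ ⊤ := ne_top_of_le_ne_top hUt (measure_mono Set.inter_subset_right)
  refine ⟨(volume (A ∩ U))⁻¹ * (2 * volume B * C' + 2 * volume U * C), ?_, fun p => ?_⟩
  · refine ENNReal.mul_ne_top (ENNReal.inv_ne_top.2 hpos) (ENNReal.add_ne_top.2 ⟨?_, ?_⟩)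
    · exact ENNReal.mul_ne_top (ENNReal.mul_ne_top (by norm_num) hB) hC'
    · exact ENNReal.mul_ne_top (ENNReal.mul_ne_top (by norm_num) hUt) hC
  have hu := measurable_fn p
  rw [mul_assoc, mul_comm, ← div_eq_mul_inv, ENNReal.le_div_iff_mul_le (Or.inl hpos) (Or.inl hW)]
  have hmeas : ∀ s : Set (EuclideanSpace ℝ (Fin d)),
      Measurable fun y => ∫⁻ x in s, ‖fn p x - fn p y‖ₑ ^ 2 := fun s =>
    Measurable.lintegral_prod_right' (f := fun z : _ × _ => ‖fn p z.2 - fn p z.1‖ₑ ^ 2)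
      (by fun_prop)
  -- Compare `u(x)` and `u(y)` through the values `u(z)`, averaged over `z ∈ A ∩ U`.
  have hpt : ∀ y x, volume (A ∩ U) * ‖fn p x - fn p y‖ₑ ^ 2 ≤
      2 * (∫⁻ z in A ∩ U, ‖fn p z - fn p x‖ₑ ^ 2) +
        2 * ∫⁻ z in A ∩ U, ‖fn p z - fn p y‖ₑ ^ 2 := by
    intro y x
    rw [← lintegral_const_mul _ (by fun_prop), ← lintegral_const_mul _ (by fun_prop),
      ← lintegral_add_left (by fun_prop), mul_comm, ← setLIntegral_const]
    refine lintegral_mono fun z => ?_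
    have := enorm_sub_sq_le (fn p x) (fn p y) (fn p z)
    rwa [← enorm_neg (fn p x - fn p z), neg_sub] at this
  calc (∫⁻ y in B, ∫⁻ x in U, ‖fn p x - fn p y‖ₑ ^ 2) * volume (A ∩ U)
      = ∫⁻ y in B, ∫⁻ x in U, volume (A ∩ U) * ‖fn p x - fn p y‖ₑ ^ 2 := by
        rw [mul_comm, ← lintegral_const_mul _ (hmeas U)]
        refine lintegral_congr fun y => ?_
        rw [lintegral_const_mul _ (by fun_prop)]
    _ ≤ ∫⁻ y in B, ∫⁻ x in U, (2 * (∫⁻ z in A ∩ U, ‖fn p z - fn p x‖ₑ ^ 2) +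
          2 * ∫⁻ z in A ∩ U, ‖fn p z - fn p y‖ₑ ^ 2) :=
        lintegral_mono fun y => lintegral_mono fun x => hpt y x
    _ = 2 * volume B * (∫⁻ x in U, ∫⁻ z in A ∩ U, ‖fn p z - fn p x‖ₑ ^ 2) +
          2 * volume U * ∫⁻ y in B, ∫⁻ z in A ∩ U, ‖fn p z - fn p y‖ₑ ^ 2 := by
        have : ∀ y, ∫⁻ x in U, (2 * (∫⁻ z in A ∩ U, ‖fn p z - fn p x‖ₑ ^ 2) +
            2 * ∫⁻ z in A ∩ U, ‖fn p z - fn p y‖ₑ ^ 2) =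
            2 * (∫⁻ x in U, ∫⁻ z in A ∩ U, ‖fn p z - fn p x‖ₑ ^ 2) +
            2 * volume U * ∫⁻ z in A ∩ U, ‖fn p z - fn p y‖ₑ ^ 2 := fun y => by
          rw [lintegral_add_right _ measurable_const, lintegral_const_mul _ (hmeas _),
            setLIntegral_const]
          ring
        rw [lintegral_congr this, lintegral_add_left measurable_const, setLIntegral_const,
          lintegral_const_mul _ (hmeas _)]
        ring
    _ ≤ 2 * volume B * (C' * ENNReal.ofReal (‖grad p‖ ^ 2)) +
          2 * volume U * (C * ENNReal.ofReal (‖grad p‖ ^ 2)) := by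
        gcongr
        · exact (lintegral_mono fun y => lintegral_mono_set Set.inter_subset_right).trans (h' p)
        · exact (lintegral_mono fun y => lintegral_mono_set Set.inter_subset_left).trans (h p)
    _ = _ := by ring

/-- Linking is passed on along translations inside `Ω`. -/
theorem IsLinked.of_translate {S : Setting d} {A A' B : Set (EuclideanSpace ℝ (Fin d))}
    (hAB : IsLinked S A B) (hA' : IsOpen A') (hB : volume B ≠ ⊤) (h : EuclideanSpace ℝ (Fin d))
    (hmaps : ∀ z ∈ A', z + h ∈ A)
    (hseg : ∀ z ∈ A', ∀ t ∈ Set.Icc (0 : ℝ) 1, z + t • h ∈ S.carrier) : IsLinked S A' B := by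
  obtain ⟨C, hC, hp⟩ := hAB
  refine ⟨2 * volume B * ENNReal.ofReal (‖h‖ ^ 2) + 2 * C, ?_, fun p => ?_⟩
  · refine ENNReal.add_ne_top.2 ⟨?_, ENNReal.mul_ne_top (by norm_num) hC⟩
    exact ENNReal.mul_ne_top (ENNReal.mul_ne_top (by norm_num) hB) ENNReal.ofReal_ne_top
  have hu := measurable_fn p
  have htr : ∀ y, ∫⁻ x in A', ‖fn p (x + h) - fn p y‖ₑ ^ 2 ≤
      ∫⁻ x in A, ‖fn p x - fn p y‖ₑ ^ 2 := by
    intro y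
    have e := (measurePreserving_add_right (volume : Measure (EuclideanSpace ℝ (Fin d)))
      h).setLIntegral_comp_preimage_emb (Homeomorph.addRight h).measurableEmbedding
      (fun x => ‖fn p x - fn p y‖ₑ ^ 2) A
    rw [← e]
    exact lintegral_mono_set fun z hz => hmaps z hz
  have hpt : ∀ y, ∫⁻ x in A', ‖fn p x - fn p y‖ₑ ^ 2 ≤
      2 * ENNReal.ofReal ((‖h‖ * ‖grad p‖) ^ 2) + 2 * ∫⁻ x in A, ‖fn p x - fn p y‖ₑ ^ 2 := by
    intro y
    calc ∫⁻ x in A', ‖fn p x - fn p y‖ₑ ^ 2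
        ≤ ∫⁻ x in A', (2 * ‖fn p (x + h) - fn p x‖ₑ ^ 2 + 2 * ‖fn p (x + h) - fn p y‖ₑ ^ 2) := by
          refine lintegral_mono fun x => ?_
          have := enorm_sub_sq_le (fn p x) (fn p y) (fn p (x + h))
          rwa [← enorm_neg (fn p x - fn p (x + h)), neg_sub] at this
      _ = 2 * (∫⁻ x in A', ‖fn p (x + h) - fn p x‖ₑ ^ 2) +
            2 * ∫⁻ x in A', ‖fn p (x + h) - fn p y‖ₑ ^ 2 := by
          rw [lintegral_add_left (by fun_prop), lintegral_const_mul _ (by fun_prop),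
            lintegral_const_mul _ (by fun_prop)]
      _ ≤ _ := by
          refine add_le_add (mul_le_mul_right ?_ 2) (mul_le_mul_right (htr y) 2)
          exact lintegral_translate_sub_sq_le S p hA' h hseg
  calc ∫⁻ y in B, ∫⁻ x in A', ‖fn p x - fn p y‖ₑ ^ 2
      ≤ ∫⁻ y in B, (2 * ENNReal.ofReal ((‖h‖ * ‖grad p‖) ^ 2) +
          2 * ∫⁻ x in A, ‖fn p x - fn p y‖ₑ ^ 2) := lintegral_mono hpt
    _ = 2 * ENNReal.ofReal ((‖h‖ * ‖grad p‖) ^ 2) * volume B +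
          2 * ∫⁻ y in B, ∫⁻ x in A, ‖fn p x - fn p y‖ₑ ^ 2 := by
        rw [lintegral_add_left measurable_const, setLIntegral_const, lintegral_const_mul]
        exact Measurable.lintegral_prod_right' (f := fun z : _ × _ => ‖fn p z.2 - fn p z.1‖ₑ ^ 2)
          (by fun_prop)
    _ ≤ 2 * ENNReal.ofReal ((‖h‖ * ‖grad p‖) ^ 2) * volume B +
          2 * (C * ENNReal.ofReal (‖grad p‖ ^ 2)) := by
        gcongr
        exact hp p
    _ = _ := by
        rw [mul_pow, ENNReal.ofReal_mul (by positivity)]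
        ring

/-- The domain is linked to a set of positive measure: a box to itself by convexity, a domain with
the segment property to any fixed ball in it, interior points by connectedness and boundary points
by pushing them into the domain. -/
theorem exists_isLinked_carrier (S : Setting d) :
    ∃ B : Set (EuclideanSpace ℝ (Fin d)), volume B ≠ 0 ∧ volume B ≠ ⊤ ∧ IsLinked S S.carrier B := by
  have hfin : ∀ A ⊆ S.carrier, volume A ≠ ⊤ := fun A hA =>
    (S.isBounded_carrier.subset hA).measure_lt_top.ne
  cases S with
  | periodic a b hab =>
    set S := Setting.periodic a b hab with hS
    refine ⟨S.carrier, (S.isOpen_carrier.measure_pos _ S.nonempty_carrier).ne', hfin _ subset_rfl,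
      isLinked_of_convex S S.isOpen_carrier ?_ subset_rfl⟩
    intro x hx y hy s t hs ht hst i
    have h1 := (convex_Ioo (a i) (b i)) (hx i) (hy i) hs ht hst
    simpa using h1
  | noFlux Ω hΩ =>
    set S := Setting.noFlux Ω hΩ with hS
    change ∃ B : Set (EuclideanSpace ℝ (Fin d)), volume B ≠ 0 ∧ volume B ≠ ⊤ ∧ IsLinked S Ω B
    replace hfin : ∀ A ⊆ Ω, volume A ≠ ⊤ := hfin
    obtain ⟨x₀, hx₀⟩ := hΩ.isConnected.nonempty
    obtain ⟨r, hr, hrΩ⟩ := Metric.isOpen_iff.1 hΩ.isOpen x₀ hx₀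
    set B := Metric.ball x₀ r
    have hBfin : volume B ≠ ⊤ := hfin B hrΩ
    refine ⟨B, (Metric.measure_ball_pos volume x₀ hr).ne', hBfin, ?_⟩
    have hBB : IsLinked S B B :=
      isLinked_of_convex S Metric.isOpen_ball (convex_ball x₀ r) hrΩ
    have hint : ∀ x ∈ Ω, ∃ V, IsOpen V ∧ x ∈ V ∧ IsLinked S V B := by
      have hsub : Ω ⊆ ⋃₀ {V | IsOpen V ∧ IsLinked S V B} := by
        refine hΩ.isConnected.isPreconnected.subset_of_closure_inter_subset
          (isOpen_sUnion fun V hV => hV.1)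
          ⟨x₀, hx₀, B, ⟨Metric.isOpen_ball, hBB⟩, Metric.mem_ball_self hr⟩ ?_
        rintro x ⟨hxc, hx⟩
        obtain ⟨ρ, hρ, hρΩ⟩ := Metric.isOpen_iff.1 hΩ.isOpen x hx
        obtain ⟨z, hz, V, ⟨hVo, hV⟩, hzV⟩ :=
          mem_closure_iff.1 hxc _ Metric.isOpen_ball (Metric.mem_ball_self hρ)
        refine ⟨Metric.ball x ρ, ⟨Metric.isOpen_ball, ?_⟩, Metric.mem_ball_self hρ⟩
        exact hV.trans (isLinked_of_convex S Metric.isOpen_ball (convex_ball x ρ) hρΩ)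
          ((hVo.inter Metric.isOpen_ball).measure_pos volume ⟨z, hzV, hz⟩).ne' hBfin
          (hfin _ hρΩ)
      intro x hx
      obtain ⟨V, ⟨hVo, hV⟩, hxV⟩ := hsub hx
      exact ⟨V, hVo, hxV, hV⟩
    have hcl : ∀ x ∈ closure Ω, ∃ V ∈ 𝓝 x, IsLinked S (V ∩ Ω) B := by
      intro x hx
      by_cases hxΩ : x ∈ Ω
      · obtain ⟨V, hVo, hxV, hV⟩ := hint x hxΩ
        exact ⟨V, hVo.mem_nhds hxV, hV.mono Set.inter_subset_left⟩
      · obtain ⟨N, hN, y, -, hy⟩ := hΩ.segment x ⟨hx, by rwa [hΩ.isOpen.interior_eq]⟩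
        obtain ⟨V, hVo, hxV, hV⟩ := hint _ (hy x ⟨hx, mem_of_mem_nhds hN⟩ (1 / 2) (by norm_num)
          (by norm_num))
        -- Half of the vector `y`, because the segment property does not reach `t = 1`.
        set h := (1 / 2 : ℝ) • y
        have hpre : IsOpen ((fun z => z + h) ⁻¹' V) := hVo.preimage (by fun_prop)
        refine ⟨interior N ∩ (fun z => z + h) ⁻¹' V,
          inter_mem (interior_mem_nhds.2 hN) (hpre.mem_nhds hxV), ?_⟩
        refine hV.of_translate ((isOpen_interior.inter hpre).inter hΩ.isOpen) hBfin h
          (fun z hz => hz.1.2) fun z hz t ht => ?_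
        rcases ht.1.eq_or_lt with rfl | ht0
        · rw [zero_smul, add_zero]
          exact hz.2
        · rw [smul_smul]
          exact hy z ⟨subset_closure hz.2, interior_subset hz.1.1⟩ _ (by linarith)
            (by linarith [ht.2])
    have hcomp : IsCompact (closure Ω) := hΩ.isBounded.isCompact_closure
    have hall : IsLinked S (closure Ω ∩ Ω) B := by
      refine hcomp.induction_on (p := fun s => IsLinked S (s ∩ Ω) B) ?_ ?_ ?_ ?_
      · simpa using isLinked_empty S B
      · exact fun s t hst ht => ht.mono (Set.inter_subset_inter_left _ hst)
      · intro s t hs ht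
        simpa only [Set.union_inter_distrib_right] using hs.union ht
      · intro x hx
        obtain ⟨V, hV, hVl⟩ := hcl x hx
        exact ⟨V, mem_nhdsWithin_of_mem_nhds hV, hVl⟩
    exact hall.mono fun x hx => ⟨subset_closure hx, hx⟩

/-- The **Poincaré inequality** on the functions with zero integral. -/
theorem exists_norm_fn_sq_le (S : Setting d) :
    ∃ C : ℝ, 0 ≤ C ∧ ∀ p ∈ meanZero S, ‖fn p‖ ^ 2 ≤ C * ‖grad p‖ ^ 2 := by
  obtain ⟨B, hB0, hBt, C, hC, h⟩ := exists_isLinked_carrier S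
  refine ⟨((volume B)⁻¹ * C).toReal, ENNReal.toReal_nonneg, fun p hp => ?_⟩
  have hsq : Integrable (fun x => fn p x ^ 2) S.vol := (Lp.memLp (fn p)).integrable_sq
  have hint : Integrable (fn p) S.vol := (Lp.memLp (fn p)).integrable (by norm_num)
  -- Among the constants, `0` is the best approximation of a function of zero mean.
  have hmin : ∀ c : ℝ, ENNReal.ofReal (‖fn p‖ ^ 2) ≤ ∫⁻ x in S.carrier, ‖fn p x - c‖ₑ ^ 2 := by
    intro c
    have hi : Integrable (fun x => (fn p x - c) ^ 2) S.vol :=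
      ((Lp.memLp (fn p)).sub (memLp_const c)).integrable_sq
    have e : ∀ x : ℝ, ‖x‖ₑ ^ 2 = ENNReal.ofReal (x ^ 2) := fun x => by
      rw [Real.enorm_eq_ofReal_abs, ← ENNReal.ofReal_pow (abs_nonneg x), sq_abs]
    simp only [e]
    rw [← ofReal_integral_eq_lintegral_ofReal hi (ae_of_all _ fun x => sq_nonneg _)]
    refine ENNReal.ofReal_le_ofReal ?_
    have e1 : ‖fn p‖ ^ 2 = ∫ x, fn p x ^ 2 ∂S.vol := by
      rw [← real_inner_self_eq_norm_sq, L2.inner_def]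
      refine integral_congr_ae (ae_of_all _ fun x => ?_)
      simp [sq]
    have e2 : ∫ x, (fn p x - c) ^ 2 ∂S.vol =
        (∫ x, fn p x ^ 2 ∂S.vol) + ∫ x, c ^ 2 ∂S.vol := by
      have e3 : ∀ x, (fn p x - c) ^ 2 = (fn p x ^ 2 - 2 * c * fn p x) + c ^ 2 := fun x => by ring
      have hp0 : ∫ x, fn p x ∂S.vol = 0 := hp
      have h1 : Integrable (fun x => 2 * c * fn p x) S.vol := hint.const_mul _
      have h2 : Integrable (fun x => fn p x ^ 2 - 2 * c * fn p x) S.vol := hsq.sub h1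
      rw [integral_congr_ae (ae_of_all _ e3), integral_add h2 (integrable_const _),
        integral_sub hsq h1, integral_const_mul, hp0, mul_zero, sub_zero]
    rw [e1, e2]
    exact le_add_of_nonneg_right (integral_nonneg fun _ => sq_nonneg c)
  have h2 : volume B * ENNReal.ofReal (‖fn p‖ ^ 2) ≤ C * ENNReal.ofReal (‖grad p‖ ^ 2) := by
    refine le_trans ?_ (h p)
    rw [mul_comm, ← setLIntegral_const]
    exact lintegral_mono fun y => hmin _
  have h3 : ENNReal.ofReal (‖fn p‖ ^ 2) ≤ (volume B)⁻¹ * C * ENNReal.ofReal (‖grad p‖ ^ 2) := by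
    rw [mul_assoc, mul_comm, ← div_eq_mul_inv, ENNReal.le_div_iff_mul_le (Or.inl hB0) (Or.inl hBt),
      mul_comm]
    exact h2
  have hfin : (volume B)⁻¹ * C ≠ ⊤ := ENNReal.mul_ne_top (ENNReal.inv_ne_top.2 hB0) hC
  have h4 := ENNReal.toReal_mono (ENNReal.mul_ne_top hfin ENNReal.ofReal_ne_top) h3
  rwa [ENNReal.toReal_mul, ENNReal.toReal_ofReal (by positivity),
    ENNReal.toReal_ofReal (by positivity)] at h4

/-! ### Constants, completeness, and uniqueness of weak gradients -/

/-- The divergence theorem on a box: the contributions of opposite faces cancel. -/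
theorem integral_fderiv_periodic_eq_zero (a b : Fin d → ℝ) (hab : ∀ i, a i < b i)
    {η : EuclideanSpace ℝ (Fin d) → ℝ} (hη : (Setting.periodic a b hab).IsTest η) (i : Fin d) :
    ∫ x, fderiv ℝ η x (EuclideanSpace.single i 1) ∂(Setting.periodic a b hab).vol = 0 := by
  obtain _ | n := d
  · exact i.elim0
  have hcd : ContDiff ℝ 1 η := hη.1.of_le (by exact_mod_cast le_top)
  let L : (Fin (n + 1) → ℝ) →L[ℝ] EuclideanSpace ℝ (Fin (n + 1)) :=
    (EuclideanSpace.equiv (Fin (n + 1)) ℝ).symm.toContinuousLinearMap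
  have hL : ∀ y, L y = WithLp.toLp 2 y := fun _ => rfl
  have e1 : ∫ x, fderiv ℝ η x (EuclideanSpace.single i 1) ∂(Setting.periodic a b hab).vol =
      ∫ y in Set.Icc a b, fderiv ℝ η (L y) (EuclideanSpace.single i 1) := by
    have h1 := (PiLp.volume_preserving_toLp (Fin (n + 1))).setIntegral_preimage_emb
      (MeasurableEquiv.toLp 2 (Fin (n + 1) → ℝ)).measurableEmbedding
      (fun x => fderiv ℝ η x (EuclideanSpace.single i 1)) (Setting.periodic a b hab).carrier
    have h2 : WithLp.toLp 2 ⁻¹' (Setting.periodic a b hab).carrier =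
        Set.pi Set.univ fun i => Set.Ioo (a i) (b i) := by
      ext y
      simp [Setting.carrier]
    rw [Setting.vol, ← h1, h2]
    exact setIntegral_congr_set Measure.univ_pi_Ioo_ae_eq_Icc
  rw [e1]
  let f : Fin (n + 1) → (Fin (n + 1) → ℝ) → ℝ := fun j => if j = i then fun y => η (L y) else 0
  let f' : Fin (n + 1) → (Fin (n + 1) → ℝ) → (Fin (n + 1) → ℝ) →L[ℝ] ℝ := fun j =>
    if j = i then fun y => (fderiv ℝ η (L y)).comp L else 0
  have hf : ∀ j y, HasFDerivAt (f j) (f' j y) y := by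
    intro j y
    by_cases hj : j = i
    · simp only [f, f', if_pos hj]
      exact ((hcd.differentiable one_ne_zero) (L y)).hasFDerivAt.comp y L.hasFDerivAt
    · simp only [f, f', if_neg hj]
      exact hasFDerivAt_const 0 y
  have hsum : ∀ y, ∑ j, f' j y (Pi.single j 1) =
      fderiv ℝ η (L y) (EuclideanSpace.single i 1) := by
    intro y
    rw [Finset.sum_eq_single i]
    · simp [f', hL]
    · intro j _ hj
      simp [f', hj]
    · simp
  have hcont : Continuous fun y => fderiv ℝ η (L y) (EuclideanSpace.single i 1) :=
    (hη.continuous_fderiv _).comp L.continuous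
  have hdiv := integral_divergence_of_hasFDerivAt_off_countable' a b (fun j => (hab j).le) f f' ∅
    Set.countable_empty (fun j y _ => (hf j y).continuousAt.continuousWithinAt)
    (fun y _ j => hf j y)
    (by simp only [hsum]; exact hcont.continuousOn.integrableOn_compact isCompact_Icc)
  simp only [hsum] at hdiv
  rw [hdiv]
  refine Finset.sum_eq_zero fun j _ => ?_
  by_cases hj : j = i
  · subst hj
    rw [sub_eq_zero]
    refine integral_congr_ae (ae_of_all _ fun y => ?_)
    simp only [f, if_pos rfl]
    have h1 := hη.2 j (L (Fin.insertNth j (a j) y))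
    rw [← h1]
    congr 1
    ext k
    refine Fin.succAboveCases j ?_ (fun m => ?_) k <;> simp [hL]
  · simp [f, hj]

theorem integral_fderiv_isTest_eq_zero (S : Setting d) {η : EuclideanSpace ℝ (Fin d) → ℝ}
    (hη : S.IsTest η) (i : Fin d) :
    ∫ x, fderiv ℝ η x (EuclideanSpace.single i 1) ∂S.vol = 0 := by
  cases S with
  | periodic a b hab => exact integral_fderiv_periodic_eq_zero a b hab hη i
  | noFlux Ω hΩ =>
    have hcd : ContDiff ℝ 1 η := hη.1.of_le (by exact_mod_cast le_top)
    have hint : IsInteriorTest Ω η := ⟨hη.1, hη.2.1, hη.2.2⟩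
    have h1 := setIntegral_eq_integral_of_forall_compl_eq_zero (μ := volume) (s := Ω)
      (f := fun x => fderiv ℝ η x (EuclideanSpace.single i 1))
      fun x hx => by rw [hint.fderiv_eq_zero hx, zero_apply]
    refine h1.trans ?_
    have h2 := integral_mul_fderiv_eq_neg_fderiv_mul_of_integrable (μ := volume)
      (f := fun _ : EuclideanSpace ℝ (Fin d) => (1 : ℝ)) (g := η)
      (v := EuclideanSpace.single i (1 : ℝ)) (by simp)
      (by
        simp only [one_mul]
        exact ((hcd.continuous_fderiv one_ne_zero).clm_apply
          continuous_const).integrable_of_hasCompactSupport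
          (hint.hasCompactSupport.fderiv_apply ℝ _))
      (by
        simp only [one_mul]
        exact hcd.continuous.integrable_of_hasCompactSupport hint.hasCompactSupport)
      (fun x _ => by fun_prop) (fun x _ => (hcd.differentiable one_ne_zero) x)
    simpa using h2

theorem Setting.memLp_of_continuous (S : Setting d) {F : Type*} [NormedAddCommGroup F]
    {g : EuclideanSpace ℝ (Fin d) → F} (hg : Continuous g) : MemLp g 2 S.vol := by
  obtain ⟨C, hC⟩ := S.isBounded_carrier.isCompact_closure.exists_bound_of_continuousOn
    hg.continuousOn
  have hm : AEStronglyMeasurable g S.vol :=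
    (hg.continuousOn.aestronglyMeasurable_of_isCompact S.isBounded_carrier.isCompact_closure
      isClosed_closure.measurableSet).mono_measure (Measure.restrict_mono subset_closure le_rfl)
  refine MemLp.of_bound hm C ?_
  filter_upwards [ae_restrict_mem S.isOpen_carrier.measurableSet] with x hx
    using hC x (subset_closure hx)

/-- The constant function `1`. -/
noncomputable def oneFn (S : Setting d) : L2 S := (memLp_const (1 : ℝ)).toLp

theorem coeFn_oneFn (S : Setting d) : oneFn S =ᵐ[S.vol] fun _ => 1 := MemLp.coeFn_toLp _

/-- The constant function `1` as an element of `H¹`. -/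
noncomputable def one (S : Setting d) : H1 S :=
  ⟨WithLp.toLp 2 (oneFn S, 0), by
    intro η hη i
    have e1 : ∫ x, (oneFn S) x * fderiv ℝ η x (EuclideanSpace.single i 1) ∂S.vol = 0 := by
      rw [← integral_fderiv_isTest_eq_zero S hη i]
      refine integral_congr_ae ?_
      filter_upwards [coeFn_oneFn S] with x hx
      rw [hx, one_mul]
    have e2 : ∫ x, (0 : L2Vec S) x i * η x ∂S.vol = 0 := by
      refine integral_eq_zero_of_ae ?_
      filter_upwards [Lp.coeFn_zero (EuclideanSpace ℝ (Fin d)) 2 S.vol] with x hx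
      rw [hx, Pi.zero_apply, PiLp.zero_apply, zero_mul, Pi.zero_apply]
    exact e1.trans (neg_eq_zero.2 e2).symm⟩

theorem fn_one (S : Setting d) : fn (one S) = oneFn S := rfl

theorem grad_one (S : Setting d) : grad (one S) = 0 := rfl

theorem isClosed_H1 (S : Setting d) : IsClosed (H1 S : Set (WithLp 2 (L2 S × L2Vec S))) := by
  have e : (H1 S : Set (WithLp 2 (L2 S × L2Vec S))) =
      ⋂ (η) (hη : S.IsTest η) (i : Fin d), {p | inner ℝ
        (S.memLp_of_continuous (hη.continuous_fderiv (EuclideanSpace.single i 1))).toLp p.fst =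
        -inner ℝ (S.memLp_of_continuous
          (hη.continuous.smul (continuous_const (y := EuclideanSpace.single i (1 : ℝ))))).toLp
          p.snd} := by
    ext p
    simp only [Set.mem_iInter]
    refine forall_congr' fun η => forall_congr' fun hη => forall_congr' fun i => ?_
    rw [Set.mem_ofPred_eq, L2.inner_def, L2.inner_def]
    refine iff_of_eq ?_
    congr 1
    · refine integral_congr_ae ?_
      filter_upwards [(S.memLp_of_continuous
        (hη.continuous_fderiv (EuclideanSpace.single i 1))).coeFn_toLp] with x hx
      rw [hx, RCLike.inner_apply, conj_trivial]
    · congr 1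
      refine integral_congr_ae ?_
      filter_upwards [(S.memLp_of_continuous (hη.continuous.smul
        (continuous_const (y := EuclideanSpace.single i (1 : ℝ))))).coeFn_toLp] with x hx
      rw [hx, Pi.smul_apply', real_inner_smul_left, EuclideanSpace.inner_single_left]
      simp [mul_comm]
  rw [e]
  refine isClosed_iInter fun η => isClosed_iInter fun hη => isClosed_iInter fun i => ?_
  exact isClosed_eq (continuous_const.inner (WithLp.continuous_fst 2 _ _))
    (continuous_const.inner (WithLp.continuous_snd 2 _ _)).neg

instance (S : Setting d) : CompleteSpace (H1 S) := (isClosed_H1 S).completeSpace_coe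

/-- An `H¹` function determines its weak gradient. -/
theorem grad_eq_zero_of_fn_eq_zero {S : Setting d} {p : H1 S} (hp : fn p = 0) : grad p = 0 := by
  have hcoord : ∀ i, ∀ᵐ x ∂S.vol, grad p x i = 0 := by
    intro i
    have hloc : LocallyIntegrableOn (fun x => grad p x i) S.carrier volume :=
      IntegrableOn.locallyIntegrableOn
        ((memLp_coord (Lp.memLp (grad p)) i).integrable (by norm_num))
    refine (ae_restrict_iff' S.isOpen_carrier.measurableSet).2
      (S.isOpen_carrier.ae_eq_zero_of_integral_contDiff_smul_eq_zero hloc fun η h1 h2 h3 => ?_)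
    have hη : IsInteriorTest S.carrier η := ⟨h1, h2, h3⟩
    have h4 := integral_mul_fderiv_eq S p hη (EuclideanSpace.single i 1)
    have h5 : ∫ x, fn p x * fderiv ℝ η x (EuclideanSpace.single i 1) ∂S.vol = 0 := by
      refine integral_eq_zero_of_ae ?_
      rw [hp]
      filter_upwards [Lp.coeFn_zero ℝ 2 S.vol] with x hx
      rw [hx, Pi.zero_apply, zero_mul]
    rw [h5, zero_eq_neg] at h4
    rw [← setIntegral_eq_integral_of_forall_compl_eq_zero (s := S.carrier)
      fun x hx => by rw [hη.eq_zero hx, zero_smul], ← h4]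
    refine integral_congr_ae (ae_of_all _ fun x => ?_)
    simp [EuclideanSpace.inner_single_right, mul_comm]
  rw [Lp.eq_zero_iff_ae_eq_zero]
  filter_upwards [ae_all_iff.2 hcoord] with x hx
  ext i
  exact hx i

theorem ext_fn {S : Setting d} {p q : H1 S} (h : fn p = fn q) : p = q := by
  have h1 : fn (p - q) = 0 := by
    change fn p - fn q = 0
    rw [h, sub_self]
  have h2 : grad (p - q) = 0 := grad_eq_zero_of_fn_eq_zero h1
  have h3 : grad p - grad q = 0 := h2
  refine Subtype.ext (WithLp.ofLp_injective 2 (Prod.ext h (sub_eq_zero.1 h3)))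

/-! ### The linear system in Hilbert space -/

section Hilbert

variable {X Y Z : Type*} [NormedAddCommGroup X] [InnerProductSpace ℝ X]
  [NormedAddCommGroup Y] [InnerProductSpace ℝ Y] [NormedAddCommGroup Z] [InnerProductSpace ℝ Z]

/-- The functional-analytic content of the spaces: `f` and `g` stand for `u ↦ u` and `u ↦ ∇u` on
`H¹`, `e` for the constant function `1`, `V` for the functions of zero mean, and `T` for the
multiplication of gradients by the mobility. -/
structure IsWeakModel (V : Submodule ℝ X) (f : X →L[ℝ] Y) (g : X →L[ℝ] Z) (e : X)
    (T : Z →L[ℝ] Z) : Prop where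
  norm_sq : ∀ u, ‖u‖ ^ 2 = ‖f u‖ ^ 2 + ‖g u‖ ^ 2
  grad_e : g e = 0
  f_e : f e ≠ 0
  mem_V : ∀ u, u ∈ V ↔ inner ℝ (f e) (f u) = 0
  poincare : ∃ C : ℝ, 0 ≤ C ∧ ∀ u ∈ V, ‖f u‖ ^ 2 ≤ C * ‖g u‖ ^ 2
  symm_T : ∀ z z', inner ℝ (T z) z' = inner ℝ (T z') z
  coercive_T : ∃ c : ℝ, 0 < c ∧ ∀ z, c * ‖z‖ ^ 2 ≤ inner ℝ (T z) z

/-- The form `(P φ, ψ)`, with `a = ε²` and `H` the multiplication by `H†`. -/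
noncomputable def hilbertP (f : X →L[ℝ] Y) (g : X →L[ℝ] Z) (H : Y →L[ℝ] Y) (a : ℝ) :
    X →L[ℝ] X →L[ℝ] ℝ :=
  (a / 2) • (innerSL ℝ).bilinearComp g g +
    (1 / 4 : ℝ) • (innerSL ℝ).bilinearComp (H.comp f) (H.comp f)

theorem hilbertP_apply (f : X →L[ℝ] Y) (g : X →L[ℝ] Z) (H : Y →L[ℝ] Y) (a : ℝ) (u w : X) :
    hilbertP f g H a u w =
      a / 2 * inner ℝ (g u) (g w) + 1 / 4 * inner ℝ (H (f u)) (H (f w)) := rfl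

theorem hilbertP_symm (f : X →L[ℝ] Y) (g : X →L[ℝ] Z) (H : Y →L[ℝ] Y) (a : ℝ) (u w : X) :
    hilbertP f g H a u w = hilbertP f g H a w u := by
  rw [hilbertP_apply, hilbertP_apply, real_inner_comm (g u), real_inner_comm (H (f u))]

/-- The operator `A` of the linear system, with the inverse operator `R = Δ⁻¹`. -/
noncomputable def hilbertA (V : Submodule ℝ X) (f : X →L[ℝ] Y) (g : X →L[ℝ] Z)
    (R : Y →L[ℝ] X) (H : Y →L[ℝ] Y) (a δ : ℝ) : V →L[ℝ] V →L[ℝ] ℝ :=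
  let fV : V →L[ℝ] Y := f.comp V.subtypeL
  let D : V →L[ℝ] V →L[ℝ] ℝ := (innerSL ℝ).bilinearComp (f.comp (R.comp fV)) fV
  (-(1 / δ)) • D + (hilbertP f g H a).bilinearComp V.subtypeL V.subtypeL

theorem hilbertA_apply (V : Submodule ℝ X) (f : X →L[ℝ] Y) (g : X →L[ℝ] Z)
    (R : Y →L[ℝ] X) (H : Y →L[ℝ] Y) (a δ : ℝ) (ψ χ : V) :
    hilbertA V f g R H a δ ψ χ =
      -(1 / δ) * inner ℝ (f (R (f ψ))) (f χ) + hilbertP f g H a ψ χ := rfl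

namespace IsWeakModel

variable {V : Submodule ℝ X} {f : X →L[ℝ] Y} {g : X →L[ℝ] Z} {e : X} {T : Z →L[ℝ] Z}

theorem grad_ne_zero (m : IsWeakModel V f g e T) {u : X} (hu : u ∈ V) (h0 : u ≠ 0) :
    g u ≠ 0 := by
  obtain ⟨C, -, hC⟩ := m.poincare
  intro hg
  have h1 := hC u hu
  have h2 := m.norm_sq u
  rw [hg] at h1 h2
  have h3 : ‖u‖ ^ 2 ≤ 0 := by rw [h2]; simpa using h1
  exact h0 (norm_eq_zero.1 (pow_eq_zero_iff two_ne_zero |>.1 (le_antisymm h3 (sq_nonneg _))))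

theorem grad_eq_zero (m : IsWeakModel V f g e T) {z : Z} (hz : inner ℝ (T z) z = 0) : z = 0 := by
  obtain ⟨c, hc, hcT⟩ := m.coercive_T
  have h1 := hcT z
  rw [hz] at h1
  exact norm_eq_zero.1 (pow_eq_zero_iff two_ne_zero |>.1
    (le_antisymm (nonpos_of_mul_nonpos_right h1 hc) (sq_nonneg _)))

/-- The gradient norm controls the `H¹` norm on `V`. -/
theorem exists_norm_sq_le (m : IsWeakModel V f g e T) :
    ∃ c : ℝ, 0 < c ∧ ∀ u ∈ V, c * ‖u‖ ^ 2 ≤ ‖g u‖ ^ 2 := by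
  obtain ⟨C, hC0, hC⟩ := m.poincare
  refine ⟨(C + 1)⁻¹, by positivity, fun u hu => ?_⟩
  rw [inv_mul_le_iff₀ (by positivity), m.norm_sq u, add_mul, one_mul]
  gcongr
  exact hC u hu

theorem isClosed (m : IsWeakModel V f g e T) : IsClosed (V : Set X) := by
  have : (V : Set X) = {u | inner ℝ (f e) (f u) = 0} := Set.ext fun u => m.mem_V u
  rw [this]
  exact isClosed_eq (by fun_prop) continuous_const

/-- Every element is the sum of one of zero mean and a constant. -/
theorem exists_add_smul (m : IsWeakModel V f g e T) (u : X) :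
    ∃ w ∈ V, ∃ s : ℝ, u = w + s • e := by
  have h0 : inner ℝ (f e) (f e) ≠ 0 := inner_self_ne_zero.2 m.f_e
  refine ⟨u - (inner ℝ (f e) (f u) / inner ℝ (f e) (f e)) • e, ?_, _, (sub_add_cancel _ _).symm⟩
  rw [m.mem_V, map_sub, map_smul, inner_sub_right, inner_smul_right, div_mul_cancel₀ _ h0,
    sub_self]

theorem inner_T_grad_e (m : IsWeakModel V f g e T) (u : X) : inner ℝ (T (g u)) (g e) = 0 := by
  rw [m.grad_e, inner_zero_right]

/-- Solutions of zero mean of the elliptic equation are unique. -/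
theorem eq_of_forall_inner_T (m : IsWeakModel V f g e T) {v v' : X} (hv : v ∈ V) (hv' : v' ∈ V)
    (h : ∀ w, inner ℝ (T (g v)) (g w) = inner ℝ (T (g v')) (g w)) : v = v' := by
  by_contra hne
  refine m.grad_ne_zero (V.sub_mem hv hv') (sub_ne_zero.2 hne) (m.grad_eq_zero ?_)
  rw [map_sub, map_sub, inner_sub_left, ← map_sub g, h, sub_self]

/-- The operator `Δ⁻¹`, by the Lax–Milgram theorem. -/
theorem exists_inverse [CompleteSpace X] [CompleteSpace Y] (m : IsWeakModel V f g e T) :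
    ∃ R : Y →L[ℝ] X, (∀ y, R y ∈ V) ∧
      ∀ y, inner ℝ (f e) y = 0 → ∀ w, -inner ℝ (T (g (R y))) (g w) = inner ℝ y (f w) := by
  have : CompleteSpace V := m.isClosed.completeSpace_coe
  let gV : V →L[ℝ] Z := g.comp V.subtypeL
  let fV : V →L[ℝ] Y := f.comp V.subtypeL
  let K : V →L[ℝ] V →L[ℝ] ℝ := (innerSL ℝ).bilinearComp (T.comp gV) gV
  have hK : IsCoercive K := by
    obtain ⟨c, hc, h1⟩ := m.coercive_T
    obtain ⟨c', hc', h2⟩ := m.exists_norm_sq_le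
    refine ⟨c * c', mul_pos hc hc', fun u => ?_⟩
    calc c * c' * ‖u‖ * ‖u‖ = c * (c' * ‖(u : X)‖ ^ 2) := by rw [Submodule.coe_norm]; ring
      _ ≤ c * ‖g u‖ ^ 2 := by gcongr; exact h2 u u.2
      _ ≤ _ := h1 _
  let Φ := hK.continuousLinearEquivOfBilin
  let R : Y →L[ℝ] X :=
    -(V.subtypeL.comp ((Φ.symm : V →L[ℝ] V).comp (ContinuousLinearMap.adjoint fV)))
  have hR : ∀ y, R y = -((Φ.symm (ContinuousLinearMap.adjoint fV y) : V) : X) := fun y => rfl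
  refine ⟨R, fun y => ?_, fun y hy w => ?_⟩
  · rw [hR]
    exact V.neg_mem (Subtype.mem _)
  · obtain ⟨w₀, hw₀, s, rfl⟩ := m.exists_add_smul w
    have h1 := hK.continuousLinearEquivOfBilin_apply
      (Φ.symm (ContinuousLinearMap.adjoint fV y)) ⟨w₀, hw₀⟩
    have h2 : hK.continuousLinearEquivOfBilin (Φ.symm (ContinuousLinearMap.adjoint fV y)) =
      ContinuousLinearMap.adjoint fV y := Φ.apply_symm_apply _
    rw [h2, ContinuousLinearMap.adjoint_inner_left] at h1
    rw [map_add, map_add, map_smul, map_smul, inner_add_right, inner_add_right, inner_smul_right,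
      inner_smul_right, m.inner_T_grad_e, real_inner_comm (f e) y, hy, mul_zero, add_zero,
      add_zero, hR, map_neg, map_neg, inner_neg_left, neg_neg]
    exact h1.symm

/-- `A` is symmetric because `(-Δ⁻¹ ψ, χ) = (M ∇ Δ⁻¹ ψ, ∇ Δ⁻¹ χ)`. -/
theorem hilbertA_symm (m : IsWeakModel V f g e T) {R : Y →L[ℝ] X}
    (hR : ∀ y, inner ℝ (f e) y = 0 → ∀ w, -inner ℝ (T (g (R y))) (g w) = inner ℝ y (f w))
    (H : Y →L[ℝ] Y) (a δ : ℝ) (ψ χ : V) :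
    hilbertA V f g R H a δ ψ χ = hilbertA V f g R H a δ χ ψ := by
  have h1 := hR (f χ) ((m.mem_V χ).1 χ.2) (R (f ψ))
  have h2 := hR (f ψ) ((m.mem_V ψ).1 ψ.2) (R (f χ))
  rw [hilbertA_apply, hilbertA_apply, hilbertP_symm f g H a ψ χ, real_inner_comm (f χ), ← h1,
    real_inner_comm (f ψ), ← h2, m.symm_T]

theorem le_hilbertP (H : Y →L[ℝ] Y) (a : ℝ) (u : X) :
    a / 2 * ‖g u‖ ^ 2 ≤ hilbertP f g H a u u := by
  rw [hilbertP_apply, real_inner_self_eq_norm_sq, real_inner_self_eq_norm_sq]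
  exact le_add_of_nonneg_right (by positivity)

theorem le_hilbertA (m : IsWeakModel V f g e T) {R : Y →L[ℝ] X}
    (hR : ∀ y, inner ℝ (f e) y = 0 → ∀ w, -inner ℝ (T (g (R y))) (g w) = inner ℝ y (f w))
    (H : Y →L[ℝ] Y) (a : ℝ) {δ : ℝ} (hδ : 0 < δ) (ψ : V) :
    a / 2 * ‖g ψ‖ ^ 2 ≤ hilbertA V f g R H a δ ψ ψ := by
  obtain ⟨c, hc, hcT⟩ := m.coercive_T
  have h1 := hR (f ψ) ((m.mem_V ψ).1 ψ.2) (R (f ψ))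
  have h2 : 0 ≤ inner ℝ (T (g (R (f ψ)))) (g (R (f ψ))) :=
    (by positivity : 0 ≤ c * ‖g (R (f ψ))‖ ^ 2).trans (hcT _)
  refine (le_hilbertP (f := f) H a (ψ : X)).trans ?_
  rw [hilbertA_apply, real_inner_comm (f ψ), ← h1, neg_mul_neg]
  exact le_add_of_nonneg_left (mul_nonneg (by positivity) h2)

theorem hilbertP_pos (m : IsWeakModel V f g e T) (H : Y →L[ℝ] Y) {a : ℝ} (ha : 0 < a) {u : X}
    (hu : u ∈ V) (h0 : u ≠ 0) : 0 < hilbertP f g H a u u := by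
  have := norm_pos_iff.2 (m.grad_ne_zero hu h0)
  exact (by positivity : 0 < a / 2 * ‖g u‖ ^ 2).trans_le (le_hilbertP H a u)

theorem hilbertA_pos (m : IsWeakModel V f g e T) {R : Y →L[ℝ] X}
    (hR : ∀ y, inner ℝ (f e) y = 0 → ∀ w, -inner ℝ (T (g (R y))) (g w) = inner ℝ y (f w))
    (H : Y →L[ℝ] Y) {a : ℝ} (ha : 0 < a) {δ : ℝ} (hδ : 0 < δ) {ψ : V} (h0 : ψ ≠ 0) :
    0 < hilbertA V f g R H a δ ψ ψ := by
  have := norm_pos_iff.2 (m.grad_ne_zero ψ.2 (by simpa using h0))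
  exact (by positivity : 0 < a / 2 * ‖g ψ‖ ^ 2).trans_le (m.le_hilbertA hR H a hδ ψ)

/-- The equation `A ψ = ℓ` is uniquely solvable, by the Lax–Milgram theorem. -/
theorem existsUnique_hilbertA [CompleteSpace X] (m : IsWeakModel V f g e T) {R : Y →L[ℝ] X}
    (hR : ∀ y, inner ℝ (f e) y = 0 → ∀ w, -inner ℝ (T (g (R y))) (g w) = inner ℝ y (f w))
    (H : Y →L[ℝ] Y) {a : ℝ} (ha : 0 < a) {δ : ℝ} (hδ : 0 < δ) (ℓ : V →L[ℝ] ℝ) :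
    ∃! ψ, hilbertA V f g R H a δ ψ = ℓ := by
  have : CompleteSpace V := m.isClosed.completeSpace_coe
  have hA : IsCoercive (hilbertA V f g R H a δ) := by
    obtain ⟨c, hc, h⟩ := m.exists_norm_sq_le
    refine ⟨a / 2 * c, by positivity, fun u => ?_⟩
    calc a / 2 * c * ‖u‖ * ‖u‖ = a / 2 * (c * ‖(u : X)‖ ^ 2) := by rw [Submodule.coe_norm]; ring
      _ ≤ a / 2 * ‖g u‖ ^ 2 := by gcongr; exact h u u.2
      _ ≤ _ := m.le_hilbertA hR H a hδ u
  refine ⟨hA.continuousLinearEquivOfBilin.symm ((InnerProductSpace.toDual ℝ V).symm ℓ), ?_, ?_⟩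
  · ext χ
    have h1 := hA.continuousLinearEquivOfBilin_apply
      (hA.continuousLinearEquivOfBilin.symm ((InnerProductSpace.toDual ℝ V).symm ℓ)) χ
    rw [← h1, ContinuousLinearEquiv.apply_symm_apply, InnerProductSpace.toDual_symm_apply]
  · rintro ψ rfl
    rw [ContinuousLinearEquiv.eq_symm_apply]
    refine ext_inner_right ℝ fun χ => ?_
    rw [hA.continuousLinearEquivOfBilin_apply, InnerProductSpace.toDual_symm_apply]

end IsWeakModel

/-- The linear system for `(φ, μ)` in weak form; `ℓ` is the functional `w ↦ (g, w)`. -/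
structure IsHilbertStep (f : X →L[ℝ] Y) (g : X →L[ℝ] Z) (T : Z →L[ℝ] Z) (H : Y →L[ℝ] Y)
    (a δ : ℝ) (ℓ : X →L[ℝ] ℝ) (φn φ μ : X) : Prop where
  evolution : ∀ w, inner ℝ ((1 / δ) • (f φ - f φn)) (f w) = -inner ℝ (T (g μ)) (g w)
  chemical : ∀ w, inner ℝ (f μ) (f w) = hilbertP f g H a φ w + ℓ w

namespace IsWeakModel

variable {V : Submodule ℝ X} {f : X →L[ℝ] Y} {g : X →L[ℝ] Z} {e : X} {T : Z →L[ℝ] Z}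

/-- The second component of a solution is determined by the first one. -/
theorem step_unique_right (m : IsWeakModel V f g e T) {H : Y →L[ℝ] Y} {a δ : ℝ}
    {ℓ : X →L[ℝ] ℝ} {φn φ μ μ' : X} (h : IsHilbertStep f g T H a δ ℓ φn φ μ)
    (h' : IsHilbertStep f g T H a δ ℓ φn φ μ') : μ = μ' := by
  have hg : g (μ - μ') = 0 := by
    refine m.grad_eq_zero ?_
    have h1 := h.evolution (μ - μ')
    rw [h'.evolution] at h1
    rw [map_sub, map_sub, inner_sub_left, ← map_sub g]
    linarith
  have hf : inner ℝ (f (μ - μ')) (f (μ - μ')) = 0 := by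
    have h1 := h.chemical (μ - μ')
    rw [← h'.chemical] at h1
    rw [map_sub, inner_sub_left, ← map_sub f, h1, sub_self]
  have h2 := m.norm_sq (μ - μ')
  rw [hg, inner_self_eq_zero.1 hf, norm_zero, norm_zero] at h2
  exact sub_eq_zero.1 (norm_eq_zero.1 (pow_eq_zero_iff two_ne_zero |>.1 (h2.trans (by norm_num))))

/-- The linear system is the equation for `A` and `ψ = φ - α`. The additive constant of `μ` is
recovered from the second equation tested with constants. -/
theorem exists_step_iff (m : IsWeakModel V f g e T) {R : Y →L[ℝ] X} (hRV : ∀ y, R y ∈ V)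
    (hR : ∀ y, inner ℝ (f e) y = 0 → ∀ w, -inner ℝ (T (g (R y))) (g w) = inner ℝ y (f w))
    (H : Y →L[ℝ] Y) (a : ℝ) {δ : ℝ} (hδ : 0 < δ) (ℓ : X →L[ℝ] ℝ) {φn : X} {α : ℝ}
    (hα : φn - α • e ∈ V) {v : X} (hv : v ∈ V)
    (hvw : ∀ w, -inner ℝ (T (g v)) (g w) = inner ℝ ((1 / δ) • (f φn - α • f e)) (f w)) (φ : X) :
    (∃ μ, IsHilbertStep f g T H a δ ℓ φn φ μ) ↔
      ∃ ψ : V, φ = ψ + α • e ∧ ∀ χ : V, hilbertA V f g R H a δ ψ χ =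
        -inner ℝ (f v) (f χ) - (ℓ χ + α * hilbertP f g H a e χ) := by
  have hδ' : (1 / δ) ≠ 0 := by positivity
  have hμ : ∀ ψ : V, ∀ w, inner ℝ ((1 / δ) • (f (ψ + α • e) - f φn)) (f w) =
      -inner ℝ (T (g ((1 / δ) • R (f ψ) - v))) (g w) := by
    intro ψ w
    have h1 := hR _ ((m.mem_V ψ).1 ψ.2) w
    have h2 := hvw w
    simp only [map_add, map_sub, map_smul, inner_add_left, inner_sub_left, inner_smul_left,
      conj_trivial, ← h1] at h2 ⊢
    linear_combination h2
  have hμ₀P : ∀ ψ χ : V, inner ℝ (f ((1 / δ) • R (f ψ) - v)) (f χ) =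
      hilbertP f g H a (ψ + α • e) χ + ℓ χ ↔ hilbertA V f g R H a δ ψ χ =
        -inner ℝ (f v) (f χ) - (ℓ χ + α * hilbertP f g H a e χ) := by
    intro ψ χ
    rw [hilbertA_apply, map_sub, map_smul, inner_sub_left, inner_smul_left, map_add, map_smul]
    simp only [add_apply, smul_apply, smul_eq_mul, conj_trivial]
    constructor <;> intro h <;> linear_combination -h
  constructor
  · rintro ⟨μ, h⟩
    -- The first equation with `w = e` is conservation of mass.
    have hψ : φ - α • e ∈ V := by
      have h1 := h.evolution e
      rw [m.grad_e, inner_zero_right, neg_zero, inner_smul_left, mul_eq_zero] at h1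
      have h2 := h1.resolve_left hδ'
      have h3 : φ - φn ∈ V := by
        rw [m.mem_V, map_sub, real_inner_comm]
        exact h2
      have := V.add_mem h3 hα
      rwa [sub_add_sub_cancel] at this
    refine ⟨⟨φ - α • e, hψ⟩, (sub_add_cancel _ _).symm, fun χ => (hμ₀P _ χ).1 ?_⟩
    set ψ : V := ⟨φ - α • e, hψ⟩
    have hφ : φ = ψ + α • e := (sub_add_cancel _ _).symm
    obtain ⟨μ₁, hμ₁, s, rfl⟩ := m.exists_add_smul μ
    have hμ01 : μ₁ = (1 / δ) • R (f ψ) - v := by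
      refine m.eq_of_forall_inner_T hμ₁ (V.sub_mem (V.smul_mem _ (hRV _)) hv) fun w => ?_
      have h1 := h.evolution w
      rw [hφ, hμ ψ w, map_add g μ₁, map_smul g s, m.grad_e, smul_zero, add_zero] at h1
      linarith
    have h2 := h.chemical χ
    rwa [hμ01, map_add f, map_smul f s, inner_add_left, inner_smul_left, (m.mem_V _).1 χ.2,
      mul_zero, add_zero, hφ] at h2
  · rintro ⟨ψ, rfl, hψ⟩
    have hμ₀V : (1 / δ) • R (f ψ) - v ∈ V := V.sub_mem (V.smul_mem _ (hRV _)) hv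
    have hμψ := hμ ψ
    replace hψ := fun χ => (hμ₀P ψ χ).2 (hψ χ)
    set μ₀ := (1 / δ) • R (f ψ) - v
    have he : inner ℝ (f e) (f e) ≠ 0 := inner_self_ne_zero.2 m.f_e
    -- This constant makes the second equation hold for `w = e`.
    set s := (hilbertP f g H a (ψ + α • e) e + ℓ e) / inner ℝ (f e) (f e)
    refine ⟨μ₀ + s • e, ⟨fun w => ?_, fun w => ?_⟩⟩
    · rw [hμψ, map_add, map_smul, m.grad_e, smul_zero, add_zero]
    · obtain ⟨w₀, hw₀, t, rfl⟩ := m.exists_add_smul w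
      have h1 : inner ℝ (f μ₀) (f w₀) = hilbertP f g H a (ψ + α • e) w₀ + ℓ w₀ := hψ ⟨w₀, hw₀⟩
      have h2 : inner ℝ (f μ₀) (f e) = 0 := by
        rw [real_inner_comm]
        exact (m.mem_V _).1 hμ₀V
      have h3 : inner ℝ (f e) (f w₀) = 0 := (m.mem_V _).1 hw₀
      have h4 : s * inner ℝ (f e) (f e) = hilbertP f g H a (ψ + α • e) e + ℓ e :=
        div_mul_cancel₀ _ he
      rw [map_add f, map_add f, map_smul f, map_smul f, inner_add_left, inner_add_right,
        inner_add_right, inner_smul_left, inner_smul_left, inner_smul_right, inner_smul_right,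
        h1, h2, h3, map_add (hilbertP f g H a (ψ + α • e)), map_smul _ t e, map_add ℓ,
        map_smul ℓ t e, smul_eq_mul, smul_eq_mul, conj_trivial]
      linear_combination t * h4

/-- Unique solvability of the linear system. -/
theorem existsUnique_step [CompleteSpace X] (m : IsWeakModel V f g e T) {R : Y →L[ℝ] X}
    (hRV : ∀ y, R y ∈ V)
    (hR : ∀ y, inner ℝ (f e) y = 0 → ∀ w, -inner ℝ (T (g (R y))) (g w) = inner ℝ y (f w))
    (H : Y →L[ℝ] Y) {a : ℝ} (ha : 0 < a) {δ : ℝ} (hδ : 0 < δ) (ℓ : X →L[ℝ] ℝ) (φn : X) :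
    ∃! p : X × X, IsHilbertStep f g T H a δ ℓ φn p.1 p.2 := by
  obtain ⟨w, hw, α, hφn⟩ := m.exists_add_smul φn
  have hα : φn - α • e ∈ V := by rwa [hφn, add_sub_cancel_right]
  obtain ⟨v, hv, hvw⟩ : ∃ v ∈ V, ∀ w,
      -inner ℝ (T (g v)) (g w) = inner ℝ ((1 / δ) • (f φn - α • f e)) (f w) := by
    refine ⟨R ((1 / δ) • (f φn - α • f e)), hRV _, hR _ ?_⟩
    rw [inner_smul_right, ← map_smul, ← map_sub, (m.mem_V _).1 hα, mul_zero]
  have hiff := m.exists_step_iff hRV hR H a hδ ℓ hα hv hvw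
  let b : V →L[ℝ] ℝ := (-(innerSL ℝ (f v)).comp f -
    (ℓ + α • hilbertP f g H a e)).comp V.subtypeL
  have hb : ∀ χ : V, b χ = -inner ℝ (f v) (f χ) -
    (ℓ χ + α * hilbertP f g H a e χ) := fun χ => rfl
  simp only [← hb] at hiff
  obtain ⟨ψ, hψ, huniq⟩ := m.existsUnique_hilbertA hR H ha hδ b
  obtain ⟨μ, hμ⟩ := (hiff (ψ + α • e)).2 ⟨ψ, rfl, fun χ => by rw [hψ]⟩
  refine ⟨(ψ + α • e, μ), hμ, ?_⟩
  rintro ⟨φ, μ'⟩ h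
  obtain ⟨ψ', hφ, hψ'⟩ := (hiff φ).1 ⟨μ', h⟩
  obtain rfl : ψ' = ψ := huniq ψ' (ContinuousLinearMap.ext hψ')
  obtain rfl : φ = ψ' + α • e := hφ
  exact Prod.ext rfl (m.step_unique_right h hμ)

end IsWeakModel

end Hilbert

/-! ### The forms of the scheme as inner products -/

/-- Multiplication by a bounded function is a continuous operator on `L²`. -/
theorem exists_mulOp {α F : Type*} {mα : MeasurableSpace α} {ν : Measure α}
    [NormedAddCommGroup F] [NormedSpace ℝ F] {k : α → ℝ} (hk : AEStronglyMeasurable k ν) {C : ℝ}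
    (hC : ∀ x, |k x| ≤ C) :
    ∃ T : Lp F 2 ν →L[ℝ] Lp F 2 ν, ∀ u, T u =ᵐ[ν] fun x => k x • u x := by
  have hle : ∀ (u : Lp F 2 ν) x, ‖k x • u x‖ ≤ C * ‖u x‖ := fun u x => by
    rw [norm_smul, Real.norm_eq_abs]
    gcongr
    exact hC x
  have hm : ∀ u : Lp F 2 ν, MemLp (fun x => k x • u x) 2 ν := fun u =>
    (Lp.memLp u).of_le_mul (hk.smul (Lp.aestronglyMeasurable u)) (ae_of_all _ (hle u))
  refine ⟨LinearMap.mkContinuous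
    { toFun := fun u => (hm u).toLp
      map_add' := fun u v => ?_
      map_smul' := fun c u => ?_ } C fun u => ?_, fun u => (hm u).coeFn_toLp⟩
  · ext1
    filter_upwards [(hm (u + v)).coeFn_toLp, (hm u).coeFn_toLp, (hm v).coeFn_toLp,
      Lp.coeFn_add u v, Lp.coeFn_add (hm u).toLp (hm v).toLp] with x h1 h2 h3 h4 h5
    rw [h1, h5, Pi.add_apply, h2, h3, h4, Pi.add_apply, smul_add]
  · ext1
    filter_upwards [(hm (c • u)).coeFn_toLp, (hm u).coeFn_toLp, Lp.coeFn_smul c u,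
      Lp.coeFn_smul c (hm u).toLp] with x h1 h2 h3 h4
    rw [h1, RingHom.id_apply, h4, Pi.smul_apply, h2, h3, Pi.smul_apply, smul_comm]
  · refine Lp.norm_le_mul_norm_of_ae_le_mul ?_
    filter_upwards [(hm u).coeFn_toLp] with x hx
    exact (congrArg norm hx).trans_le (hle u x)

theorem inner_eq_integral {α F : Type*} {mα : MeasurableSpace α} {ν : Measure α}
    [NormedAddCommGroup F] [InnerProductSpace ℝ F] {u v : Lp F 2 ν} {u' v' : α → F}
    (hu : u =ᵐ[ν] u') (hv : v =ᵐ[ν] v') : inner ℝ u v = ∫ x, inner ℝ (u' x) (v' x) ∂ν := by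
  rw [L2.inner_def]
  refine integral_congr_ae ?_
  filter_upwards [hu, hv] with x h1 h2
  rw [h1, h2]

/-- `u ↦ u` as a continuous operator from `H¹` to `L²`. -/
noncomputable def fnL (S : Setting d) : H1 S →L[ℝ] L2 S :=
  (WithLp.fstL 2 ℝ (L2 S) (L2Vec S)).comp (H1 S).subtypeL

/-- `u ↦ ∇u` as a continuous operator from `H¹` to `L²`. -/
noncomputable def gradL (S : Setting d) : H1 S →L[ℝ] L2Vec S :=
  (WithLp.sndL 2 ℝ (L2 S) (L2Vec S)).comp (H1 S).subtypeL

theorem fnL_apply {S : Setting d} (u : H1 S) : fnL S u = fn u := rfl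

theorem gradL_apply {S : Setting d} (u : H1 S) : gradL S u = grad u := rfl

theorem inner_oneFn {S : Setting d} (u : L2 S) : inner ℝ (oneFn S) u = ∫ x, u x ∂S.vol := by
  rw [inner_eq_integral (coeFn_oneFn S) EventuallyEq.rfl]
  simp

theorem oneFn_ne_zero (S : Setting d) : oneFn S ≠ 0 := by
  intro h
  have h1 : ∀ᵐ x ∂S.vol, False := by
    filter_upwards [coeFn_oneFn S, (Lp.eq_zero_iff_ae_eq_zero.1 h)] with x h2 h3
    rw [h3] at h2
    exact zero_ne_one h2
  rw [ae_iff] at h1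
  simp only [not_false_eq_true, Set.ofPred_true, Measure.restrict_apply_univ] at h1
  exact (S.isOpen_carrier.measure_pos volume S.nonempty_carrier).ne' h1

theorem sub_mean_mem_meanZero {S : Setting d} (u : H1 S) : u - mean u • one S ∈ meanZero S := by
  have h0 : volume.real S.carrier ≠ 0 := by
    rw [Measure.real, ENNReal.toReal_ne_zero]
    exact ⟨(S.isOpen_carrier.measure_pos volume S.nonempty_carrier).ne',
      S.isBounded_carrier.measure_lt_top.ne⟩
  change ∫ x, fn (u - mean u • one S) x ∂S.vol = 0
  rw [← inner_oneFn]
  change inner ℝ (oneFn S) (fn u - mean u • oneFn S) = 0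
  have h1 : inner ℝ (oneFn S) (oneFn S) = volume.real S.carrier := by
    rw [inner_eq_integral (coeFn_oneFn S) (coeFn_oneFn S)]
    simp
  rw [inner_sub_right, inner_smul_right, h1, inner_oneFn, mean, div_mul_cancel₀ _ h0, sub_self]

/-- The spaces of the scheme, with `T` the multiplication by the mobility, given by a function `k`
bounded below by `c > 0`. -/
theorem isWeakModel {S : Setting d} {k : EuclideanSpace ℝ (Fin d) → ℝ} {c : ℝ} (hc : 0 < c)
    (hk : ∀ x, c ≤ k x) {T : L2Vec S →L[ℝ] L2Vec S} (hT : ∀ z, T z =ᵐ[S.vol] fun x => k x • z x) :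
    IsWeakModel (meanZero S) (fnL S) (gradL S) (one S) T where
  norm_sq u := WithLp.prod_norm_sq_eq_of_L2 u.1
  grad_e := grad_one S
  f_e := oneFn_ne_zero S
  mem_V u := by
    change ∫ x, fn u x ∂S.vol = 0 ↔ inner ℝ (oneFn S) (fn u) = 0
    rw [inner_oneFn]
  poincare := exists_norm_fn_sq_le S
  symm_T z z' := by
    rw [inner_eq_integral (hT z) EventuallyEq.rfl, inner_eq_integral (hT z') EventuallyEq.rfl]
    refine integral_congr_ae (ae_of_all _ fun x => ?_)
    simp only [real_inner_smul_left]
    rw [real_inner_comm]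
  coercive_T := by
    refine ⟨c, hc, fun z => ?_⟩
    rw [← real_inner_self_eq_norm_sq, L2.inner_def, L2.inner_def, ← integral_const_mul]
    refine integral_mono_ae ((L2.integrable_inner (𝕜 := ℝ) z z).const_mul c)
      (L2.integrable_inner (T z) z) ?_
    filter_upwards [hT z] with x hx
    rw [hx, real_inner_smul_left]
    exact mul_le_mul_of_nonneg_right (hk x) real_inner_self_nonneg

theorem mobilityForm_eq {S : Setting d} {σ : ℝ} {φdag : EuclideanSpace ℝ (Fin d) → ℝ}
    {T : L2Vec S →L[ℝ] L2Vec S} (hT : ∀ z, T z =ᵐ[S.vol] fun x => mobility σ (φdag x) • z x)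
    (u w : H1 S) : mobilityForm σ φdag u w = inner ℝ (T (grad u)) (grad w) := by
  rw [inner_eq_integral (hT _) EventuallyEq.rfl]
  simp only [real_inner_smul_left]
  rfl

theorem dissipation_eq {S : Setting d} {σ : ℝ} (hσ : 0 < σ) (hσ' : σ < 1 / 2)
    (φdag : EuclideanSpace ℝ (Fin d) → ℝ) (μ : H1 S) :
    dissipation σ φdag μ = mobilityForm σ φdag μ μ := by
  refine integral_congr_ae (ae_of_all _ fun x => ?_)
  have h : 0 ≤ mobility σ (φdag x) := by linarith [(mobility_bounds hσ hσ' (φdag x)).1]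
  simp only
  rw [norm_smul, mul_pow, Real.norm_eq_abs, sq_abs, Real.sq_sqrt h, real_inner_self_eq_norm_sq]

theorem inner_mulOp {S : Setting d} {k : EuclideanSpace ℝ (Fin d) → ℝ}
    {H : L2 S →L[ℝ] L2 S} (hH : ∀ u, H u =ᵐ[S.vol] fun x => k x • u x) (u v : L2 S) :
    inner ℝ (H u) v = inner ℝ u (H v) := by
  rw [inner_eq_integral (hH u) EventuallyEq.rfl, inner_eq_integral EventuallyEq.rfl (hH v)]
  simp only [real_inner_smul_left, real_inner_smul_right]

section Step

variable {S : Setting d} {ε σ θ B δt : ℝ} {φprev φn : H1 S} {Un : L2 S} {H : L2 S →L[ℝ] L2 S}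

theorem pForm_eq {φdag : EuclideanSpace ℝ (Fin d) → ℝ}
    (hH : ∀ u, H u =ᵐ[S.vol] fun x => hFun σ θ B (φdag x) • u x) (φ ψ : H1 S) :
    pForm ε σ θ B φdag φ ψ = hilbertP (fnL S) (gradL S) H (ε ^ 2) φ ψ := by
  rw [hilbertP_apply, inner_eq_integral (hH _) (hH _), L2.inner_def]
  simp only [fnL_apply, gradL_apply, RCLike.inner_apply, conj_trivial, smul_eq_mul]
  unfold pForm
  congr 2
  refine integral_congr_ae (ae_of_all _ fun x => ?_)
  exact mul_comm _ _

/-- The functional `ψ ↦ (g, ψ)` of the linear system. -/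
noncomputable def gL (ε : ℝ) (φn : H1 S) (Un : L2 S) (H : L2 S →L[ℝ] L2 S) : H1 S →L[ℝ] ℝ :=
  (ε ^ 2 / 2) • (innerSL ℝ (grad φn)).comp (gradL S) +
    (innerSL ℝ (H Un - (1 / 4 : ℝ) • H (H (fn φn)))).comp (fnL S)

theorem gL_apply (ψ : H1 S) : gL ε φn Un H ψ = ε ^ 2 / 2 * inner ℝ (grad φn) (grad ψ) +
    inner ℝ (H Un - (1 / 4 : ℝ) • H (H (fn φn))) (fn ψ) := rfl

theorem gForm_eq
    (hH : ∀ u, H u =ᵐ[S.vol] fun x => hFun σ θ B (extrapolate φprev φn x) • u x) (α : ℝ)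
    (ψ : H1 S) : gForm ε σ θ B φprev φn Un α ψ =
      gL ε φn Un H ψ + α * hilbertP (fnL S) (gradL S) H (ε ^ 2) (one S) ψ := by
  have h1 : (H Un - (1 / 4 : ℝ) • H (H (fn φn)) + (1 / 4 * α) • H (H (oneFn S)) : L2 S)
      =ᵐ[S.vol] fun x => hFun σ θ B (extrapolate φprev φn x) * Un x
      - (1 / 4) * hFun σ θ B (extrapolate φprev φn x) ^ 2 * fn φn x
      + (1 / 4) * hFun σ θ B (extrapolate φprev φn x) ^ 2 * α := by
    filter_upwards [Lp.coeFn_add (H Un - (1 / 4 : ℝ) • H (H (fn φn)))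
        ((1 / 4 * α) • H (H (oneFn S))), Lp.coeFn_sub (H Un) ((1 / 4 : ℝ) • H (H (fn φn))),
      Lp.coeFn_smul (1 / 4 : ℝ) (H (H (fn φn))), Lp.coeFn_smul (1 / 4 * α) (H (H (oneFn S))),
      hH Un, hH (fn φn), hH (H (fn φn)), hH (oneFn S), hH (H (oneFn S)), coeFn_oneFn S]
      with x a1 a2 a3 a4 a5 a6 a7 a8 a9 a10
    rw [a1, Pi.add_apply, a2, Pi.sub_apply, a3, a4, Pi.smul_apply, Pi.smul_apply, a5, a7, a6, a9,
      a8, a10]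
    simp only [smul_eq_mul]
    ring
  have h2 : gForm ε σ θ B φprev φn Un α ψ = ε ^ 2 / 2 * inner ℝ (grad φn) (grad ψ) +
      inner ℝ (H Un - (1 / 4 : ℝ) • H (H (fn φn)) + (1 / 4 * α) • H (H (oneFn S))) (fn ψ) := by
    rw [inner_eq_integral h1 EventuallyEq.rfl, L2.inner_def]
    unfold gForm
    congr 1
    refine integral_congr_ae (ae_of_all _ fun x => ?_)
    simp only [RCLike.inner_apply, conj_trivial]
    exact mul_comm _ _
  rw [h2, gL_apply, hilbertP_apply, inner_add_left, inner_smul_left, inner_mulOp hH,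
    gradL_apply (one S), grad_one, inner_zero_left, fnL_apply, fnL_apply, fn_one, conj_trivial]
  ring

theorem coeFn_sub_div (u v : L2 S) (c : ℝ) :
    ((1 / c) • (u - v) : L2 S) =ᵐ[S.vol] fun x => (u x - v x) / c := by
  filter_upwards [Lp.coeFn_smul (1 / c) (u - v), Lp.coeFn_sub u v] with x h1 h2
  rw [h1, Pi.smul_apply, h2, Pi.sub_apply, smul_eq_mul, one_div, inv_mul_eq_div]

theorem integral_mul_eq_inner {u v : L2 S} {u' : EuclideanSpace ℝ (Fin d) → ℝ}
    (hu : u =ᵐ[S.vol] u') : ∫ x, u' x * v x ∂S.vol = inner ℝ u v := by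
  rw [inner_eq_integral hu EventuallyEq.rfl]
  refine integral_congr_ae (ae_of_all _ fun x => ?_)
  simp only [RCLike.inner_apply, conj_trivial]
  exact mul_comm _ _

theorem isReducedStep_iff {T : L2Vec S →L[ℝ] L2Vec S}
    (hT : ∀ z, T z =ᵐ[S.vol] fun x => mobility σ (extrapolate φprev φn x) • z x)
    (hH : ∀ u, H u =ᵐ[S.vol] fun x => hFun σ θ B (extrapolate φprev φn x) • u x) (φ μ : H1 S) :
    IsReducedStep ε σ θ B δt φprev φn Un φ μ ↔
      IsHilbertStep (fnL S) (gradL S) T H (ε ^ 2) δt (gL ε φn Un H) φn φ μ := by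
  have h1 : (∀ w : H1 S, ∫ x, (fn φ x - fn φn x) / δt * fn w x ∂S.vol =
      -mobilityForm σ (extrapolate φprev φn) μ w) ↔ ∀ w,
      inner ℝ ((1 / δt) • (fnL S φ - fnL S φn)) (fnL S w) =
        -inner ℝ (T (gradL S μ)) (gradL S w) := by
    refine forall_congr' fun w => ?_
    rw [integral_mul_eq_inner (coeFn_sub_div (fn φ) (fn φn) δt), mobilityForm_eq hT]
    rfl
  have h2 : (∀ w : H1 S, ∫ x, fn μ x * fn w x ∂S.vol =
      pForm ε σ θ B (extrapolate φprev φn) φ w + gForm ε σ θ B φprev φn Un 0 w) ↔ ∀ w,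
      inner ℝ (fnL S μ) (fnL S w) = hilbertP (fnL S) (gradL S) H (ε ^ 2) φ w +
        gL ε φn Un H w := by
    refine forall_congr' fun w => ?_
    rw [integral_mul_eq_inner EventuallyEq.rfl, pForm_eq hH, gForm_eq hH, zero_mul, add_zero]
    rfl
  exact ⟨fun h => ⟨h1.1 h.1, h2.1 h.2⟩, fun h => ⟨h1.2 h.1, h2.2 h.2⟩⟩

theorem isInvLaplace_iff {φdag : EuclideanSpace ℝ (Fin d) → ℝ} {T : L2Vec S →L[ℝ] L2Vec S}
    (hT : ∀ z, T z =ᵐ[S.vol] fun x => mobility σ (φdag x) • z x) {y : L2 S}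
    {u : EuclideanSpace ℝ (Fin d) → ℝ} (hu : y =ᵐ[S.vol] u) (v : H1 S) :
    IsInvLaplace σ φdag u v ↔ v ∈ meanZero S ∧
      ∀ w, -inner ℝ (T (gradL S v)) (gradL S w) = inner ℝ y (fnL S w) := by
  have h1 : (∀ w : H1 S, -mobilityForm σ φdag v w = ∫ x, u x * fn w x ∂S.vol) ↔
      ∀ w, -inner ℝ (T (gradL S v)) (gradL S w) = inner ℝ y (fnL S w) := by
    refine forall_congr' fun w => ?_
    rw [mobilityForm_eq hT, integral_mul_eq_inner hu]
    rfl
  exact ⟨fun h => ⟨h.1, h1.1 h.2⟩, fun h => ⟨h.1, h1.2 h.2⟩⟩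

/-- The right-hand side of the second equation of the scheme, as inner products. -/
theorem chemical_rhs_eq
    (hH : ∀ u, H u =ᵐ[S.vol] fun x => hFun σ θ B (extrapolate φprev φn x) • u x)
    (φ w : H1 S) (U : L2 S) :
    ε ^ 2 * (∫ x, inner ℝ ((1 / 2 : ℝ) • (grad φ x + grad φn x)) (grad w x) ∂S.vol) +
      (∫ x, (U x + Un x) / 2 * hFun σ θ B (extrapolate φprev φn x) * fn w x ∂S.vol) =
    ε ^ 2 / 2 * inner ℝ (grad φ + grad φn) (grad w) +
      1 / 2 * inner ℝ (U + Un) (H (fn w)) := by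
  have h1 : (((1 / 2 : ℝ) • (grad φ + grad φn) : L2Vec S)) =ᵐ[S.vol]
      fun x => (1 / 2 : ℝ) • (grad φ x + grad φn x) := by
    filter_upwards [Lp.coeFn_smul (1 / 2 : ℝ) (grad φ + grad φn),
      Lp.coeFn_add (grad φ) (grad φn)] with x a1 a2
    rw [a1, Pi.smul_apply, a2, Pi.add_apply]
  have h2 : (((1 / 2 : ℝ) • H (U + Un) : L2 S)) =ᵐ[S.vol]
      fun x => (U x + Un x) / 2 * hFun σ θ B (extrapolate φprev φn x) := by
    filter_upwards [Lp.coeFn_smul (1 / 2 : ℝ) (H (U + Un)), hH (U + Un),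
      Lp.coeFn_add U Un] with x a1 a2 a3
    rw [a1, Pi.smul_apply, a2, a3, Pi.add_apply, smul_eq_mul, smul_eq_mul]
    ring
  rw [← inner_eq_integral h1 EventuallyEq.rfl, integral_mul_eq_inner h2, inner_smul_left,
    inner_smul_left, inner_mulOp hH]
  simp only [conj_trivial]
  ring

/-- The third equation of the scheme, as an equation in `L²`. -/
theorem auxiliary_iff
    (hH : ∀ u, H u =ᵐ[S.vol] fun x => hFun σ θ B (extrapolate φprev φn x) • u x)
    (φ : H1 S) (U : L2 S) :
    (∀ᵐ x ∂S.vol, U x = hFun σ θ B (extrapolate φprev φn x) / 2 * fn φ x +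
      (Un x - hFun σ θ B (extrapolate φprev φn x) / 2 * fn φn x)) ↔
    U = Un + (1 / 2 : ℝ) • H (fn φ - fn φn) := by
  have h : (Un + (1 / 2 : ℝ) • H (fn φ - fn φn) : L2 S) =ᵐ[S.vol]
      fun x => hFun σ θ B (extrapolate φprev φn x) / 2 * fn φ x +
      (Un x - hFun σ θ B (extrapolate φprev φn x) / 2 * fn φn x) := by
    filter_upwards [Lp.coeFn_add Un ((1 / 2 : ℝ) • H (fn φ - fn φn)),
      Lp.coeFn_smul (1 / 2 : ℝ) (H (fn φ - fn φn)), hH (fn φ - fn φn),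
      Lp.coeFn_sub (fn φ) (fn φn)] with x a1 a2 a3 a4
    rw [a1, Pi.add_apply, a2, Pi.smul_apply, a3, a4, Pi.sub_apply, smul_eq_mul, smul_eq_mul]
    ring
  constructor
  · intro hU
    exact Lp.ext (EventuallyEq.trans hU h.symm)
  · rintro rfl
    exact h

/-- Eliminating `Uⁿ⁺¹` turns the scheme into the linear system for `(φ, μ)`. -/
theorem isStep_iff
    (hH : ∀ u, H u =ᵐ[S.vol] fun x => hFun σ θ B (extrapolate φprev φn x) • u x)
    (φ : H1 S) (U : L2 S) (μ : H1 S) :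
    IsStep ε σ θ B δt φprev φn Un φ U μ ↔
      IsReducedStep ε σ θ B δt φprev φn Un φ μ ∧
        U = Un + (1 / 2 : ℝ) • H (fn φ - fn φn) := by
  have haux : (∀ᵐ x ∂S.vol, 2 * (U x - Un x) =
      hFun σ θ B (extrapolate φprev φn x) * (fn φ x - fn φn x)) ↔
      U = Un + (1 / 2 : ℝ) • H (fn φ - fn φn) := by
    rw [← auxiliary_iff hH φ U]
    refine eventually_congr (ae_of_all _ fun x => ?_)
    constructor <;> intro h <;> linarith
  have hchem : U = Un + (1 / 2 : ℝ) • H (fn φ - fn φn) → ∀ w : H1 S,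
      ε ^ 2 * (∫ x, inner ℝ ((1 / 2 : ℝ) • (grad φ x + grad φn x)) (grad w x) ∂S.vol) +
        (∫ x, (U x + Un x) / 2 * hFun σ θ B (extrapolate φprev φn x) * fn w x ∂S.vol) =
      pForm ε σ θ B (extrapolate φprev φn) φ w + gForm ε σ θ B φprev φn Un 0 w := by
    rintro rfl w
    rw [chemical_rhs_eq hH, pForm_eq hH, gForm_eq hH, hilbertP_apply, gL_apply]
    simp only [fnL_apply, gradL_apply, map_sub, inner_add_left, inner_sub_left, inner_smul_left,
      conj_trivial, inner_mulOp hH Un, inner_mulOp hH (H (fn φn))]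
    ring
  constructor
  · intro h
    have hU := haux.1 h.auxiliary
    exact ⟨⟨h.evolution, fun w => (h.chemical w).trans (hchem hU w)⟩, hU⟩
  · rintro ⟨h, hU⟩
    exact ⟨h.evolution, fun w => (h.chemical w).trans (hchem hU w).symm, haux.2 hU⟩

/-- The discrete energy law: test the first equation with `μ` and the second one with
`φⁿ⁺¹ - φⁿ`. -/
theorem energy_law (hσ : 0 < σ) (hσ' : σ < 1 / 2)
    (hH : ∀ u, H u =ᵐ[S.vol] fun x => hFun σ θ B (extrapolate φprev φn x) • u x)
    {φ : H1 S} {U : L2 S} {μ : H1 S} (h : IsStep ε σ θ B δt φprev φn Un φ U μ) :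
    (1 / δt) * (energy ε B φ U - energy ε B φn Un) =
      -dissipation σ (extrapolate φprev φn) μ := by
  have h1 := h.evolution μ
  have h2 := h.chemical (φ - φn)
  have h3 : (2 : ℝ) • (U - Un) = H (fn φ - fn φn) := by
    rw [((isStep_iff hH φ U μ).1 h).2, add_sub_cancel_left, smul_smul]
    norm_num
  rw [chemical_rhs_eq hH, integral_mul_eq_inner EventuallyEq.rfl] at h2
  change inner ℝ (fn μ) (fn φ - fn φn) = ε ^ 2 / 2 * inner ℝ (grad φ + grad φn)
    (grad φ - grad φn) + 1 / 2 * inner ℝ (U + Un) (H (fn φ - fn φn)) at h2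
  rw [integral_mul_eq_inner (coeFn_sub_div (fn φ) (fn φn) δt), inner_smul_left,
    real_inner_comm, h2, conj_trivial] at h1
  rw [dissipation_eq hσ hσ', ← h1, ← h3, inner_smul_right]
  simp only [energy, inner_add_left, inner_sub_right, real_inner_self_eq_norm_sq,
    real_inner_comm (grad φ) (grad φn), real_inner_comm U Un]
  ring

end Step

end CahnHilliard

theorem theorem3p4 {d : ℕ} (S : Setting d) (ε σ θ B δt : ℝ)
    (hε : 0 < ε) (hσ : 0 < σ) (hσ' : σ < 1 / 2) (hθ : 1 < θ)
    (hB : ∀ s : ℝ, 0 < potential σ θ s + B) (hδt : 0 < δt)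
    (φprev φn : H1 S) (Un : L2 S) :
    -- unique solvability of the scheme
    (∃! p : H1 S × L2 S × H1 S,
      IsStep ε σ θ B δt φprev φn Un p.1 p.2.1 p.2.2) ∧
    -- unique solvability of the linear system for `(φ, μ)`, and its equivalence with the scheme
    (∃! p : H1 S × H1 S,
      IsReducedStep ε σ θ B δt φprev φn Un p.1 p.2) ∧
    (∀ (φ : H1 S) (U : L2 S) (μ : H1 S),
      IsStep ε σ θ B δt φprev φn Un φ U μ ↔
        IsReducedStep ε σ θ B δt φprev φn Un φ μ ∧
        ∀ᵐ x ∂S.vol, U x =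
          hFun σ θ B (extrapolate φprev φn x) / 2 * fn φ x +
          (Un x - hFun σ θ B (extrapolate φprev φn x) / 2 * fn φn x)) ∧
    -- discrete energy law
    (∀ (φ : H1 S) (U : L2 S) (μ : H1 S),
      IsStep ε σ θ B δt φprev φn Un φ U μ →
        (1 / δt) * (energy ε B φ U - energy ε B φn Un) =
          -dissipation σ (extrapolate φprev φn) μ ∧
        -dissipation σ (extrapolate φprev φn) μ ≤ 0) ∧
    -- `Δ⁻¹` is defined on all square integrable functions with zero integral
    (∀ u : L2 S, ∫ x, u x ∂S.vol = 0 →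
      ∃! v : H1 S,
        IsInvLaplace σ (extrapolate φprev φn) u v) ∧
    -- `P` is symmetric, and positive definite on functions with zero integral
    (∀ φ ψ : H1 S,
      pForm ε σ θ B (extrapolate φprev φn) φ ψ =
        pForm ε σ θ B (extrapolate φprev φn) ψ φ) ∧
    (∀ ψ ∈ meanZero S, ψ ≠ 0 →
      0 < pForm ε σ θ B (extrapolate φprev φn) ψ ψ) ∧
    -- the operator `A ψ = -(1 / δt) Δ⁻¹ ψ + P ψ` (modulo constants) of the linear system
    ∃ A : meanZero S →L[ℝ] (meanZero S →L[ℝ] ℝ),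
      (∀ (ψ χ : meanZero S) (v : H1 S),
        IsInvLaplace σ (extrapolate φprev φn) (fn ψ.1) v →
          A ψ χ = -(1 / δt) * (∫ x, fn v x * fn χ.1 x ∂S.vol) +
            pForm ε σ θ B (extrapolate φprev φn) ψ.1 χ.1) ∧
      -- the scheme is the equation `A ψ = b` for `ψ = φ - α`, where `α` is the mean of `φⁿ`
      (∀ φ : H1 S,
        (∃ (U : L2 S) (μ : H1 S),
          IsStep ε σ θ B δt φprev φn Un φ U μ) ↔
        ∃ (ψ : meanZero S) (v : H1 S),
          (∀ᵐ x ∂S.vol, fn φ x = fn ψ.1 x + mean φn) ∧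
          IsInvLaplace σ (extrapolate φprev φn)
            (fun x => (fn φn x - mean φn) / δt) v ∧
          ∀ χ : meanZero S,
            A ψ χ = -(∫ x, fn v x * fn χ.1 x ∂S.vol) -
              gForm ε σ θ B φprev φn Un (mean φn) χ.1) ∧
      -- `A` is symmetric and positive definite
      (∀ ψ χ : meanZero S, A ψ χ = A χ ψ) ∧
      (∀ ψ : meanZero S, ψ ≠ 0 → 0 < A ψ ψ) := by
  have hφm : AEStronglyMeasurable (extrapolate φprev φn) S.vol :=
    ((Lp.aestronglyMeasurable (fn φn)).const_mul _).sub
      ((Lp.aestronglyMeasurable (fn φprev)).const_mul _)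
  obtain ⟨T, hT⟩ := exists_mulOp (F := EuclideanSpace ℝ (Fin d)) (ν := S.vol)
    (k := fun x => mobility σ (extrapolate φprev φn x)) (C := 1 / 4)
    ((measurable_mobility σ).comp_aemeasurable hφm.aemeasurable).aestronglyMeasurable
    fun x => by
      have h := mobility_bounds hσ hσ' (extrapolate φprev φn x)
      exact abs_le.2 ⟨by linarith, h.2⟩
  obtain ⟨H, hH⟩ := exists_mulOp (F := ℝ) (ν := S.vol)
    (k := fun x => hFun σ θ B (extrapolate φprev φn x)) (C := Real.sqrt (2 * (2 / σ)))
    ((measurable_hFun σ θ B).comp_aemeasurable hφm.aemeasurable).aestronglyMeasurable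
    fun x => abs_hFun_le hσ hσ' hθ hB _
  have m := isWeakModel (by positivity : 0 < σ / 8)
    (fun x => (mobility_bounds hσ hσ' (extrapolate φprev φn x)).1) hT
  obtain ⟨R, hRV, hR⟩ := m.exists_inverse
  have hε2 : 0 < ε ^ 2 := by positivity
  have hstep := fun φ U μ => isStep_iff (ε := ε) (δt := δt) (Un := Un) hH φ U μ
  have hred := fun φ μ => isReducedStep_iff (ε := ε) (δt := δt) (Un := Un) hT hH φ μ
  have hsolve := m.existsUnique_step hRV hR H hε2 hδt (gL ε φn Un H) φn
  simp only [← hred] at hsolve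
  have hV : ∀ u : L2 S, ∫ x, u x ∂S.vol = 0 → inner ℝ (fnL S (one S)) u = 0 := fun u hu =>
    (inner_oneFn u).trans hu
  have hinv : ∀ u : L2 S, ∫ x, u x ∂S.vol = 0 →
      IsInvLaplace σ (extrapolate φprev φn) u (R u) := fun u hu =>
    (isInvLaplace_iff hT EventuallyEq.rfl (R u)).2 ⟨hRV u, hR u (hV u hu)⟩
  have huniq : ∀ (u : L2 S) (v v' : H1 S), IsInvLaplace σ (extrapolate φprev φn) u v →
      IsInvLaplace σ (extrapolate φprev φn) u v' → v = v' := by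
    intro u v v' h h'
    rw [isInvLaplace_iff hT EventuallyEq.rfl] at h h'
    exact m.eq_of_forall_inner_T h.1 h'.1 fun w => neg_injective ((h.2 w).trans (h'.2 w).symm)
  refine ⟨?_, hsolve, fun φ U μ => ?_, fun φ U μ h => ?_, fun u hu => ?_, fun φ ψ => ?_,
    fun ψ hψ h0 => ?_, hilbertA (meanZero S) (fnL S) (gradL S) R H (ε ^ 2) δt,
    fun ψ χ v hv => ?_, fun φ => ?_, fun ψ χ => m.hilbertA_symm hR H _ _ ψ χ,
    fun ψ h0 => m.hilbertA_pos hR H hε2 hδt h0⟩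
  · obtain ⟨⟨φ, μ⟩, h, hu⟩ := hsolve
    refine ⟨(φ, Un + (1 / 2 : ℝ) • H (fn φ - fn φn), μ), (hstep _ _ _).2 ⟨h, rfl⟩, ?_⟩
    rintro ⟨φ', U', μ'⟩ h'
    obtain ⟨h1, h2⟩ := (hstep _ _ _).1 h'
    obtain ⟨rfl, rfl⟩ := Prod.mk.inj (hu (φ', μ') h1)
    exact congrArg (fun U => (φ', U, μ')) h2
  · rw [hstep, auxiliary_iff hH]
  · refine ⟨energy_law hσ hσ' hH h, neg_nonpos.2 ?_⟩
    exact integral_nonneg fun x => sq_nonneg _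
  · exact ⟨R u, hinv u hu, fun v hv => huniq u v (R u) hv (hinv u hu)⟩
  · rw [pForm_eq hH, pForm_eq hH, hilbertP_symm]
  · rw [pForm_eq hH]
    exact m.hilbertP_pos H hε2 hψ h0
  · rw [hilbertA_apply, pForm_eq hH, huniq _ v (R (fn ψ.1)) hv (hinv _ ψ.2),
      integral_mul_eq_inner EventuallyEq.rfl]
    rfl
  · have hα := sub_mean_mem_meanZero φn
    have hy : ((1 / δt) • (fn φn - mean φn • oneFn S) : L2 S) =ᵐ[S.vol]
        fun x => (fn φn x - mean φn) / δt := by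
      filter_upwards [coeFn_sub_div (fn φn) (mean φn • oneFn S) δt,
        Lp.coeFn_smul (mean φn) (oneFn S), coeFn_oneFn S] with x h1 h2 h3
      rw [h1, h2, Pi.smul_apply, h3, smul_eq_mul, mul_one]
    have hv₀ : IsInvLaplace σ (extrapolate φprev φn) (fun x => (fn φn x - mean φn) / δt)
        (R ((1 / δt) • (fn φn - mean φn • oneFn S))) := by
      refine (isInvLaplace_iff hT hy _).2 ⟨hRV _, hR _ ?_⟩
      rw [inner_smul_right]
      exact mul_eq_zero_of_right _ ((m.mem_V _).1 hα)
    have hconst : ∀ ψ : meanZero S, φ = ψ + mean φn • one S ↔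
        ∀ᵐ x ∂S.vol, fn φ x = fn ψ.1 x + mean φn := by
      intro ψ
      have h1 : fn (ψ.1 + mean φn • one S) =ᵐ[S.vol] fun x => fn ψ.1 x + mean φn := by
        change (fn ψ.1 + mean φn • oneFn S : L2 S) =ᵐ[S.vol] _
        filter_upwards [Lp.coeFn_add (fn ψ.1) (mean φn • oneFn S),
          Lp.coeFn_smul (mean φn) (oneFn S), coeFn_oneFn S] with x h1 h2 h3
        rw [h1, Pi.add_apply, h2, Pi.smul_apply, h3, smul_eq_mul, mul_one]
      constructor
      · intro h
        rw [h]
        exact h1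
      · intro h
        exact ext_fn (Lp.ext (EventuallyEq.trans h h1.symm))
    have hrhs : ∀ (v : H1 S) (χ : meanZero S), -(∫ x, fn v x * fn χ.1 x ∂S.vol) -
        gForm ε σ θ B φprev φn Un (mean φn) χ.1 = -inner ℝ (fnL S v) (fnL S χ) -
        (gL ε φn Un H χ + mean φn * hilbertP (fnL S) (gradL S) H (ε ^ 2) (one S) χ) := by
      intro v χ
      rw [gForm_eq hH, integral_mul_eq_inner EventuallyEq.rfl]
      rfl
    have hiff : ∀ v, IsInvLaplace σ (extrapolate φprev φn)
        (fun x => (fn φn x - mean φn) / δt) v → _ := fun v hv =>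
      m.exists_step_iff hRV hR H (ε ^ 2) hδt (gL ε φn Un H) hα hv.1
        ((isInvLaplace_iff hT hy v).1 hv).2 φ
    simp only [← hred, ← hrhs, hconst] at hiff
    constructor
    · rintro ⟨U, μ, h⟩
      obtain ⟨ψ, h1, h2⟩ := (hiff _ hv₀).1 ⟨μ, ((hstep _ _ _).1 h).1⟩
      exact ⟨ψ, _, h1, hv₀, h2⟩
    · rintro ⟨ψ, v, h1, hv, h2⟩
      obtain ⟨μ, hμ⟩ := (hiff v hv).2 ⟨ψ, h1, h2⟩
      exact ⟨_, μ, (hstep _ _ _).2 ⟨hμ, rfl⟩⟩
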